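/- Let $R$ be a commutative ring with $2\in R^\times$ and let $n\ge 3$ be odd. Let $Um_n(R)$ be the set of $a\in R^n$ whose entries generate the unit ideal, with its action of $SL_n(R)$. Let $q(a,b)=\sum_{i=1}^n a_ib_i$ on $R^n\oplus R^n$ and $U_{2n-1}(R)=\{(a,b): q(a,b)=1\}$. Let $Spin_{2n}(R)$ be the group of even elements $g$ of the Clifford algebra of $q$ with $gg^*=1$ (where $*$ is the standard involution) and $g(R^n\oplus R^n)g^{-1}=R^n\oplus R^n$; it acts on $U_{2n-1}(R)$ by $x\mapsto gxg^{-1}$. Put $(h,\varepsilon)=(\sigma,1)$ if $n\equiv 1 \bmod 4$ and $(h,\varepsilon)=(\psi,-1)$ if $n\equiv 3\bmod 4$, where $\sigma_{2m}$ and $\psi_{2m}$ are the block diagonal matrices with $m$ diagonal blocks $\begin{pmatrix}0&1\\1&0\end{pmatrix}$, respectively $\begin{pmatrix}0&1\\-1&0\end{pmatrix}$; let also $\tau_{2m}$ be the one with blocks $\begin{pmatrix}0&1\\0&0\end{pmatrix}$. Let $W_\varepsilon(R)$ be the set of invertible symmetric (if $\varepsilon=1$), respectively invertible alternating (if $\varepsilon=-1$),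 matrices of even size over $R$ modulo the relation: $M$ (of size $2m$) $\sim N$ (of size $2l$) if $M\perp h_{2l+2i}=E^t(N\perp h_{2m+2i})E$ for some $i\ge1$ and some $E$ in the elementary group $E_{2m+2l+2i}(R)$. The block sum $\perp$ makes $W_\varepsilon(R)$ an abelian group. Let $C_\varepsilon(R)$ be the cokernel of the hyperbolic homomorphism $K_1(R)\to W_\varepsilon(R)$, i.e. the quotient of $W_\varepsilon(R)$ by the subgroup generated by the classes of $M^th_{2m}M$ for $m\ge 0$, $M\in GL_{2m}(R)$. Define matrices $\alpha_k(a,b)$ (for $a,b\in R^k$), $J_k$ and $E_k$ of size $2^{k-1}$ as follows. Put $\alpha_1(a,b)=(a_1)$, $J_1=(1)$, $E_1=1$, $E_2=1$. For $k\ge2$, with $a'=(a_2,\dots,a_k)$ and $b'=(b_2,\dots,b_k)$, $$\alpha_k(a,b)=\begin{pmatrix}a_1\,\mathrm{id}&\alpha_{k-1}(a',b')\\-\alpha_{k-1}(b',a')^t&b_1\,\mathrm{id}\end{pmatrix},$$ and $J_k=\begin{pmatrix}0&J_{k-1}\\-J_{k-1}&0\end{pmatrix}$ for $k$ even, $J_k=\begin{pmatrix}J_{k-1}&0\\0&-J_{k-1}\end{pmatrix}$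 for $k$ odd. For $k\ge3$, with $\sigma,\psi,\tau$ of size $2^{k-2}$, the matrix $E_k$ is $$\begin{pmatrix}1&0\\0&J_{k-1}^t\end{pmatrix}\begin{pmatrix}1&0\\\tau&1\end{pmatrix}\begin{pmatrix}1&-\sigma\\0&1\end{pmatrix}\begin{pmatrix}1&0\\0&\psi\end{pmatrix},\quad \begin{pmatrix}E_{k-1}&0\\0&E_{k-1}\end{pmatrix}\begin{pmatrix}1&0\\0&\psi\end{pmatrix},$$ $$\begin{pmatrix}1&0\\0&J_{k-1}^t\end{pmatrix}\begin{pmatrix}1&0\\\tau&1\end{pmatrix}\begin{pmatrix}1&\psi\\0&1\end{pmatrix}\begin{pmatrix}1&0\\0&\sigma\end{pmatrix},\quad \begin{pmatrix}E_{k-1}&0\\0&E_{k-1}\end{pmatrix}\begin{pmatrix}1&0\\0&\sigma\end{pmatrix}$$ for $k\equiv 0,1,2,3\bmod 4$, respectively. Put $\Psi_n(a,b)=E_n^t\,\alpha_n(a,b)\,J_n\,E_n$. Then: 1. There is a unique map $c: Um_n(R)/SL_n(R)\to U_{2n-1}(R)/Spin_{2n}(R)$ (the comparison map) with $c([a])=[(a,b)]$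 for all $(a,b)\in U_{2n-1}(R)$. 2. For every $(a,b)\in U_{2n-1}(R)$ the matrix $\Psi_n(a,b)$ is invertible, and symmetric if $n\equiv1\bmod4$, alternating if $n\equiv3\bmod 4$; and there is a unique map $d: U_{2n-1}(R)/Spin_{2n}(R)\to C_\varepsilon(R)$ with $d([(a,b)])=[\Psi_n(a,b)]$ for all $(a,b)\in U_{2n-1}(R)$. The composite $d\circ c: Um_n(R)/SL_n(R)\to C_\varepsilon(R)$ is called the degree map $\Psi_n$ modulo $SL$. 3. If the degree map $d\circ c$ is injective, then the comparison map $c$ is bijective. -/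

import Mathlib

namespace SpinUnit

open Matrix

set_option linter.unusedSectionVars false
set_option linter.unusedSimpArgs false

section Elementary

variable (ι : Type) [Fintype ι] [DecidableEq ι] (R : Type*) [CommRing R]

/-- The elementary group `E_ι(R)`: all products of elementary matrices `1 + c e_{ij}`, `i ≠ j`.
Since the inverse of an elementary matrix is elementary, the submonoid generated by these
matrices is the subgroup generated by them. -/
def elementary : Submonoid (Matrix ι ι R) :=
  Submonoid.closure {E | ∃ (i j : ι) (c : R), i ≠ j ∧ E = transvection i j c}

end Elementary

variable {R : Type*} [CommRing R]
variable {ι κ μ ν : Type} [Fintype ι] [DecidableEq ι] [Fintype κ] [DecidableEq κ]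
  [Fintype μ] [DecidableEq μ] [Fintype ν] [DecidableEq ν]

/-- The sign `ε = ±1` as an element of `R`. -/
def sgn (R : Type*) [CommRing R] (ε : ℤˣ) : R := ((ε : ℤ) : R)

lemma sgn_mul_self (ε : ℤˣ) : sgn R ε * sgn R ε = 1 := by
  rcases Int.units_eq_one_or ε with rfl | rfl <;> simp [sgn]

/-- Invertible symmetric matrices (`ε = 1`), respectively invertible alternating matrices
(`ε = -1`). -/
def IsForm (ε : ℤˣ) (M : Matrix ι ι R) : Prop :=
  IsUnit M ∧ Mᵀ = sgn R ε • M ∧ (ε = -1 → ∀ i, M i i = 0)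

/-- The block diagonal matrix with all diagonal blocks equal to the `2 × 2` matrix `B`.
The index set `Fin m × Fin 2`, ordered lexicographically, is identified with `Fin (2 m)`. -/
def pairDiag (ι : Type) [DecidableEq ι] (B : Matrix (Fin 2) (Fin 2) R) :
    Matrix (ι × Fin 2) (ι × Fin 2) R :=
  fun x y => if x.1 = y.1 then B x.2 y.2 else 0

/-- The hyperbolic form: `σ_{2m}` for `ε = 1` and `ψ_{2m}` for `ε = -1`. -/
def hyp (R : Type*) [CommRing R] (ε : ℤˣ) (ι : Type) [DecidableEq ι] :
    Matrix (ι × Fin 2) (ι × Fin 2) R :=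
  pairDiag ι !![0, 1; sgn R ε, 0]

/-- The orthogonal (block) sum of two matrices. -/
def perp (A : Matrix (ι × Fin 2) (ι × Fin 2) R) (B : Matrix (κ × Fin 2) (κ × Fin 2) R) :
    Matrix ((ι ⊕ κ) × Fin 2) ((ι ⊕ κ) × Fin 2) R :=
  (fromBlocks A 0 0 B).submatrix (Equiv.sumProdDistrib ι κ (Fin 2))
    (Equiv.sumProdDistrib ι κ (Fin 2))

/-- Relabelling of the index pairs of a matrix. -/
def relabel (e : ι ≃ κ) (A : Matrix (κ × Fin 2) (κ × Fin 2) R) :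
    Matrix (ι × Fin 2) (ι × Fin 2) R :=
  A.submatrix (Prod.map e id) (Prod.map e id)

/-- `M` and `N` are congruent through an elementary matrix. -/
def ElemCong (M N : Matrix ι ι R) : Prop :=
  ∃ E ∈ elementary ι R, M = Eᵀ * N * E

lemma elementary_inv {E : Matrix ι ι R} (hE : E ∈ elementary ι R) :
    ∃ F ∈ elementary ι R, E * F = 1 ∧ F * E = 1 := by
  induction hE using Submonoid.closure_induction with
  | mem x hx =>
    obtain ⟨i, j, c, h, rfl⟩ := hx
    refine ⟨transvection i j (-c), Submonoid.subset_closure ⟨i, j, -c, h, rfl⟩, ?_, ?_⟩ <;>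
      simp [transvection_mul_transvection_same, h]
  | one => exact ⟨1, one_mem _, by simp, by simp⟩
  | mul x y _ _ hx hy =>
    obtain ⟨a, ha, ha1, ha2⟩ := hx
    obtain ⟨b, hb, hb1, hb2⟩ := hy
    refine ⟨b * a, mul_mem hb ha, ?_, ?_⟩
    · rw [mul_assoc, ← mul_assoc y, hb1, one_mul, ha1]
    · rw [mul_assoc, ← mul_assoc a, ha2, one_mul, hb2]

lemma ElemCong.refl (M : Matrix ι ι R) : ElemCong M M := ⟨1, one_mem _, by simp⟩

lemma ElemCong.symm {M N : Matrix ι ι R} (h : ElemCong M N) : ElemCong N M := by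
  obtain ⟨E, hE, rfl⟩ := h
  obtain ⟨F, hF, h1, h2⟩ := elementary_inv hE
  refine ⟨F, hF, ?_⟩
  have h3 : Fᵀ * Eᵀ = 1 := by rw [← transpose_mul, h1, transpose_one]
  calc N = (Fᵀ * Eᵀ) * N * (E * F) := by rw [h3, h1]; simp
    _ = _ := by simp only [mul_assoc]

lemma ElemCong.trans {M N P : Matrix ι ι R} (h : ElemCong M N) (h' : ElemCong N P) :
    ElemCong M P := by
  obtain ⟨E, hE, rfl⟩ := h
  obtain ⟨F, hF, rfl⟩ := h'
  exact ⟨F * E, mul_mem hF hE, by simp only [transpose_mul, mul_assoc]⟩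

lemma elementary_submatrix (e : κ ≃ ι) {E : Matrix ι ι R} (hE : E ∈ elementary ι R) :
    E.submatrix e e ∈ elementary κ R := by
  induction hE using Submonoid.closure_induction with
  | mem x hx =>
    obtain ⟨i, j, c, h, rfl⟩ := hx
    refine Submonoid.subset_closure ⟨e.symm i, e.symm j, c, by simpa using h, ?_⟩
    ext a b
    simp [transvection, single_apply, one_apply, Equiv.symm_apply_eq]
  | one => simp
  | mul x y _ _ hx hy =>
    rw [← submatrix_mul_equiv x y e e e]
    exact mul_mem hx hy

lemma elementary_fromBlocks {E : Matrix ι ι R} (hE : E ∈ elementary ι R) :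
    fromBlocks E 0 0 (1 : Matrix κ κ R) ∈ elementary (ι ⊕ κ) R := by
  induction hE using Submonoid.closure_induction with
  | mem x hx =>
    obtain ⟨i, j, c, h, rfl⟩ := hx
    refine Submonoid.subset_closure ⟨.inl i, .inl j, c, by simpa using h, ?_⟩
    ext a b
    rcases a with a | a <;> rcases b with b | b <;>
      simp [transvection, single_apply, one_apply]
  | one => simp
  | mul x y _ _ hx hy =>
    have : fromBlocks (x * y) 0 0 (1 : Matrix κ κ R)
        = fromBlocks x 0 0 1 * fromBlocks y 0 0 1 := by
      simp [fromBlocks_multiply]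
    rw [this]
    exact mul_mem hx hy

lemma ElemCong.submatrix (e : κ ≃ ι) {M N : Matrix ι ι R} (h : ElemCong M N) :
    ElemCong (M.submatrix e e) (N.submatrix e e) := by
  obtain ⟨E, hE, rfl⟩ := h
  refine ⟨_, elementary_submatrix e hE, ?_⟩
  rw [transpose_submatrix, submatrix_mul_equiv, submatrix_mul_equiv]

lemma ElemCong.perp_left {M N : Matrix (ι × Fin 2) (ι × Fin 2) R} (h : ElemCong M N)
    (P : Matrix (κ × Fin 2) (κ × Fin 2) R) : ElemCong (perp M P) (perp N P) := by
  obtain ⟨E, hE, rfl⟩ := h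
  refine ElemCong.submatrix _ ⟨_, elementary_fromBlocks hE, ?_⟩
  simp [fromBlocks_transpose, fromBlocks_multiply]

/-- The permutation matrix `e_b ↦ e_{g b}`. -/
def permMat (R : Type*) [CommRing R] (g : Equiv.Perm ι) : Matrix ι ι R :=
  (1 : Matrix ι ι R).submatrix id g

lemma permMat_congr (g : Equiv.Perm ι) (M : Matrix ι ι R) :
    (permMat R g)ᵀ * M * permMat R g = M.submatrix g g := by
  ext a b
  simp [permMat, Matrix.mul_apply, one_apply]

lemma permMat_mul (g h : Equiv.Perm ι) : permMat R (g * h) = permMat R g * permMat R h := by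
  ext a b
  simp [permMat, Matrix.mul_apply, one_apply]

lemma transvection_mulVec (i j : ι) (c : R) (x : ι → R) :
    transvection i j c *ᵥ x = Function.update x i (x i + c * x j) := by
  ext a
  by_cases h : a = i
  · subst h
    simp [transvection, add_mulVec, Matrix.single_mulVec]
  · simp [transvection, add_mulVec, Matrix.single_mulVec, h]

lemma signedSwap_mulVec {i j : ι} (h : i ≠ j) (x : ι → R) :
    (transvection i j 1 * transvection j i (-1) * transvection i j 1) *ᵥ x =
      Function.update (Function.update x i (x j)) j (-x i) := by
  simp only [← Matrix.mulVec_mulVec, transvection_mulVec]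
  ext a
  by_cases hi : a = i
  · subst hi
    simp [Function.update_apply, h, h.symm]
  · by_cases hj : a = j
    · subst hj
      simp [Function.update_apply, h.symm]
    · simp [Function.update_apply, hi, hj]

lemma permMat_mulVec (g : Equiv.Perm ι) (x : ι → R) (b : ι) :
    (permMat R g *ᵥ x) (g b) = x b := by
  simp [permMat, mulVec, dotProduct, one_apply]

lemma permMat_threeCycle {g : Equiv.Perm ι} (hg : g.IsThreeCycle) :
    permMat R g ∈ elementary ι R := by
  obtain ⟨i, hi⟩ := hg.isCycle.nonempty_support
  have hn := hg.nodup_iff_mem_support.mpr hi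
  have hg' := hg.eq_swap_mul_swap_iff_mem_support.mpr hi
  obtain ⟨j, hj⟩ : ∃ j, g i = j := ⟨_, rfl⟩
  obtain ⟨k, hk⟩ : ∃ k, g j = k := ⟨_, rfl⟩
  rw [hj, hk] at hn hg'
  have hij : i ≠ j := by rintro rfl; simp at hn
  have hik : i ≠ k := by rintro rfl; simp at hn
  have hjk : j ≠ k := by rintro rfl; simp at hn
  have hki : g k = i := by
    rw [hg', Equiv.Perm.mul_apply, Equiv.swap_apply_right, Equiv.swap_apply_right]
  have T : ∀ (a b : ι) (c : R), a ≠ b → transvection a b c ∈ elementary ι R :=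
    fun a b c h => Submonoid.subset_closure ⟨a, b, c, h, rfl⟩
  have key : permMat R g =
      (transvection i k 1 * transvection k i (-1) * transvection i k 1) *
      (transvection j i 1 * transvection i j (-1) * transvection j i 1) := by
    apply Matrix.mulVec_injective
    ext1 x
    rw [← Matrix.mulVec_mulVec, signedSwap_mulVec hij.symm, signedSwap_mulVec hik]
    ext a
    obtain ⟨b, rfl⟩ := g.surjective a
    rw [permMat_mulVec]
    by_cases h1 : b = i
    · subst h1
      simp [hj, Function.update_apply, hij.symm, hjk]
    · by_cases h2 : b = j
      · subst h2
        simp [hk, Function.update_apply, hij]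
      · by_cases h3 : b = k
        · subst h3
          simp [hki, Function.update_apply, hik, hik.symm, hjk.symm]
        · have : g b = b := by
            rw [hg', Equiv.Perm.mul_apply, Equiv.swap_apply_of_ne_of_ne h2 h3,
              Equiv.swap_apply_of_ne_of_ne h1 h2]
          simp [this, Function.update_apply, h1, h2, h3]
  rw [key]
  exact mul_mem (mul_mem (mul_mem (T _ _ _ hik) (T _ _ _ hik.symm)) (T _ _ _ hik))
    (mul_mem (mul_mem (T _ _ _ hij.symm) (T _ _ _ hij)) (T _ _ _ hij.symm))

lemma permMat_mem {g : Equiv.Perm ι} (hg : Equiv.Perm.sign g = 1) :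
    permMat R g ∈ elementary ι R := by
  have h : g ∈ Subgroup.closure {s : Equiv.Perm ι | s.IsThreeCycle} := by
    rw [Equiv.Perm.closure_three_cycles_eq_alternating]
    exact Equiv.Perm.mem_alternatingGroup.mpr hg
  clear hg
  induction h using Subgroup.closure_induction'' with
  | mem x hx => exact permMat_threeCycle hx
  | inv_mem x hx => exact permMat_threeCycle (Equiv.Perm.IsThreeCycle.inv hx)
  | one =>
    have : permMat R (1 : Equiv.Perm ι) = 1 := by
      ext a b
      simp [permMat, one_apply]
    rw [this]
    exact one_mem _
  | mul x y _ _ hx hy =>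
    rw [permMat_mul]
    exact mul_mem hx hy

lemma elemCong_perm {g : Equiv.Perm ι} (hg : Equiv.Perm.sign g = 1) (M : Matrix ι ι R) :
    ElemCong (M.submatrix g g) M :=
  ⟨_, permMat_mem hg, (permMat_congr g M).symm⟩

lemma elemCong_relabel (g : Equiv.Perm ι) (M : Matrix (ι × Fin 2) (ι × Fin 2) R) :
    ElemCong (relabel g M) M := by
  have : relabel g M = M.submatrix (Equiv.prodCongrLeft fun _ : Fin 2 => g)
      (Equiv.prodCongrLeft fun _ : Fin 2 => g) := by
    ext ⟨a, b⟩ ⟨c, d⟩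
    simp [relabel, Equiv.prodCongrLeft]
  rw [this]
  apply elemCong_perm
  rw [Equiv.Perm.sign_prodCongrLeft]
  simp

/-- Congruence through an elementary matrix after relabelling the index pairs. -/
def PairCong (M : Matrix (ι × Fin 2) (ι × Fin 2) R) (N : Matrix (κ × Fin 2) (κ × Fin 2) R) :
    Prop :=
  ∃ e : ι ≃ κ, ElemCong M (relabel e N)

lemma relabel_relabel (e : ι ≃ κ) (f : κ ≃ μ) (M : Matrix (μ × Fin 2) (μ × Fin 2) R) :
    relabel e (relabel f M) = relabel (e.trans f) M := rfl

lemma relabel_refl (M : Matrix (ι × Fin 2) (ι × Fin 2) R) :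
    relabel (Equiv.refl ι) M = M := rfl

lemma ElemCong.relabel (e : ι ≃ κ) {M N : Matrix (κ × Fin 2) (κ × Fin 2) R}
    (h : ElemCong M N) : ElemCong (relabel e M) (relabel e N) :=
  h.submatrix (e.prodCongr (Equiv.refl (Fin 2)))

lemma PairCong.refl (M : Matrix (ι × Fin 2) (ι × Fin 2) R) : PairCong M M :=
  ⟨Equiv.refl ι, ElemCong.refl M⟩

lemma PairCong.of_relabel (e : ι ≃ κ) (M : Matrix (κ × Fin 2) (κ × Fin 2) R) :
    PairCong (relabel e M) M :=
  ⟨e, ElemCong.refl _⟩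

lemma PairCong.symm {M : Matrix (ι × Fin 2) (ι × Fin 2) R}
    {N : Matrix (κ × Fin 2) (κ × Fin 2) R} (h : PairCong M N) : PairCong N M := by
  obtain ⟨e, he⟩ := h
  refine ⟨e.symm, ?_⟩
  have := (he.relabel e.symm).symm
  rwa [relabel_relabel, Equiv.symm_trans_self, relabel_refl] at this

lemma PairCong.trans {M : Matrix (ι × Fin 2) (ι × Fin 2) R}
    {N : Matrix (κ × Fin 2) (κ × Fin 2) R} {P : Matrix (μ × Fin 2) (μ × Fin 2) R}
    (h : PairCong M N) (h' : PairCong N P) : PairCong M P := by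
  obtain ⟨e, he⟩ := h
  obtain ⟨f, hf⟩ := h'
  exact ⟨e.trans f, he.trans (hf.relabel e)⟩

lemma PairCong.elemCong {M : Matrix (ι × Fin 2) (ι × Fin 2) R}
    {N : Matrix (κ × Fin 2) (κ × Fin 2) R} (h : PairCong M N) (e : ι ≃ κ) :
    ElemCong M (SpinUnit.relabel e N) := by
  obtain ⟨f, hf⟩ := h
  refine hf.trans ?_
  have := elemCong_relabel (f.trans e.symm) (SpinUnit.relabel e N)
  rwa [relabel_relabel, Equiv.trans_assoc, Equiv.symm_trans_self, Equiv.trans_refl] at this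

lemma PairCong.perp_left {M : Matrix (ι × Fin 2) (ι × Fin 2) R}
    {N : Matrix (κ × Fin 2) (κ × Fin 2) R} (h : PairCong M N)
    (P : Matrix (μ × Fin 2) (μ × Fin 2) R) : PairCong (perp M P) (perp N P) := by
  obtain ⟨e, he⟩ := h
  refine ⟨e.sumCongr (Equiv.refl μ), ?_⟩
  have : SpinUnit.relabel (e.sumCongr (Equiv.refl μ)) (perp N P) =
      perp (SpinUnit.relabel e N) P := by
    ext ⟨a | a, i⟩ ⟨b | b, j⟩ <;> rfl
  rw [this]
  exact he.perp_left P

lemma PairCong.perp_comm (M : Matrix (ι × Fin 2) (ι × Fin 2) R)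
    (N : Matrix (κ × Fin 2) (κ × Fin 2) R) : PairCong (perp M N) (perp N M) := by
  have : perp M N = relabel (Equiv.sumComm ι κ) (perp N M) := by
    ext ⟨a | a, i⟩ ⟨b | b, j⟩ <;> rfl
  rw [this]
  exact .of_relabel _ _

lemma PairCong.perp_assoc (M : Matrix (ι × Fin 2) (ι × Fin 2) R)
    (N : Matrix (κ × Fin 2) (κ × Fin 2) R) (P : Matrix (μ × Fin 2) (μ × Fin 2) R) :
    PairCong (perp (perp M N) P) (perp M (perp N P)) := by
  have : perp (perp M N) P = relabel (Equiv.sumAssoc ι κ μ) (perp M (perp N P)) := by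
    ext ⟨(a | a) | a, i⟩ ⟨(b | b) | b, j⟩ <;> rfl
  rw [this]
  exact .of_relabel _ _

lemma PairCong.perp_congr {M : Matrix (ι × Fin 2) (ι × Fin 2) R}
    {N : Matrix (κ × Fin 2) (κ × Fin 2) R} {P : Matrix (μ × Fin 2) (μ × Fin 2) R}
    {Q : Matrix (ν × Fin 2) (ν × Fin 2) R} (h : PairCong M N) (h' : PairCong P Q) :
    PairCong (perp M P) (perp N Q) :=
  (h.perp_left P).trans
    ((PairCong.perp_comm N P).trans ((h'.perp_left N).trans (PairCong.perp_comm Q N)))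

lemma PairCong.perp_right_comm (M : Matrix (ι × Fin 2) (ι × Fin 2) R)
    (N : Matrix (κ × Fin 2) (κ × Fin 2) R) (P : Matrix (μ × Fin 2) (μ × Fin 2) R) :
    PairCong (perp (perp M N) P) (perp (perp M P) N) :=
  (PairCong.perp_assoc M N P).trans
    (((PairCong.refl M).perp_congr (PairCong.perp_comm N P)).trans
      (PairCong.perp_assoc M P N).symm)

lemma perp_hyp (ε : ℤˣ) : perp (hyp R ε ι) (hyp R ε κ) = hyp R ε (ι ⊕ κ) := by
  ext ⟨a | a, i⟩ ⟨b | b, j⟩ <;>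
    simp [perp, hyp, pairDiag, Equiv.sumProdDistrib]

lemma relabel_hyp (ε : ℤˣ) (e : ι ≃ κ) : relabel e (hyp R ε κ) = hyp R ε ι := by
  ext ⟨a, i⟩ ⟨b, j⟩
  simp [relabel, hyp, pairDiag]

lemma PairCong.hyp (ε : ℤˣ) (e : ι ≃ κ) :
    PairCong (SpinUnit.hyp R ε ι) (SpinUnit.hyp R ε κ) := by
  rw [← relabel_hyp ε e]
  exact .of_relabel _ _

lemma PairCong.perp_hyp_hyp (ε : ℤˣ) (M : Matrix (ι × Fin 2) (ι × Fin 2) R)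
    (e : κ ⊕ μ ≃ ν) :
    PairCong (perp (perp M (SpinUnit.hyp R ε κ)) (SpinUnit.hyp R ε μ))
      (perp M (SpinUnit.hyp R ε ν)) := by
  refine (PairCong.perp_assoc _ _ _).trans ((PairCong.refl M).perp_congr ?_)
  rw [perp_hyp]
  exact .hyp ε e

/-- Two matrices become congruent through an elementary matrix after adding hyperbolic forms. -/
def Stable (ε : ℤˣ) (M : Matrix (ι × Fin 2) (ι × Fin 2) R)
    (N : Matrix (κ × Fin 2) (κ × Fin 2) R) : Prop :=
  ∃ a b : ℕ, PairCong (perp M (hyp R ε (Fin a))) (perp N (hyp R ε (Fin b)))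

lemma Stable.of_pairCong {ε : ℤˣ} {M : Matrix (ι × Fin 2) (ι × Fin 2) R}
    {N : Matrix (κ × Fin 2) (κ × Fin 2) R} (h : PairCong M N) : Stable ε M N :=
  ⟨0, 0, h.perp_left _⟩

lemma Stable.symm {ε : ℤˣ} {M : Matrix (ι × Fin 2) (ι × Fin 2) R}
    {N : Matrix (κ × Fin 2) (κ × Fin 2) R} (h : Stable ε M N) : Stable ε N M := by
  obtain ⟨a, b, h⟩ := h
  exact ⟨b, a, h.symm⟩

lemma Stable.trans {ε : ℤˣ} {M : Matrix (ι × Fin 2) (ι × Fin 2) R}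
    {N : Matrix (κ × Fin 2) (κ × Fin 2) R} {P : Matrix (μ × Fin 2) (μ × Fin 2) R}
    (h : Stable ε M N) (h' : Stable ε N P) : Stable ε M P := by
  obtain ⟨a, b, h⟩ := h
  obtain ⟨c, d, h'⟩ := h'
  refine ⟨a + c, d + b, ?_⟩
  refine (PairCong.perp_hyp_hyp ε M finSumFinEquiv).symm.trans ?_
  refine (h.perp_left _).trans ?_
  refine (PairCong.perp_right_comm _ _ _).trans ?_
  exact (h'.perp_left _).trans (PairCong.perp_hyp_hyp ε P finSumFinEquiv)

lemma Stable.perp_left {ε : ℤˣ} {M : Matrix (ι × Fin 2) (ι × Fin 2) R}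
    {N : Matrix (κ × Fin 2) (κ × Fin 2) R} (h : Stable ε M N)
    (P : Matrix (μ × Fin 2) (μ × Fin 2) R) : Stable ε (perp M P) (perp N P) := by
  obtain ⟨a, b, h⟩ := h
  exact ⟨a, b, (PairCong.perp_right_comm _ _ _).trans
    ((h.perp_left P).trans (PairCong.perp_right_comm _ _ _))⟩

lemma Stable.perp_congr {ε : ℤˣ} {M : Matrix (ι × Fin 2) (ι × Fin 2) R}
    {N : Matrix (κ × Fin 2) (κ × Fin 2) R} {P : Matrix (μ × Fin 2) (μ × Fin 2) R}
    {Q : Matrix (ν × Fin 2) (ν × Fin 2) R} (h : Stable ε M N) (h' : Stable ε P Q) :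
    Stable ε (perp M P) (perp N Q) :=
  (h.perp_left P).trans ((Stable.of_pairCong (PairCong.perp_comm N P)).trans
    ((h'.perp_left N).trans (Stable.of_pairCong (PairCong.perp_comm Q N))))

lemma Stable.perp_hyp {ε : ℤˣ} (M : Matrix (ι × Fin 2) (ι × Fin 2) R) (a : ℕ) :
    Stable ε (perp M (hyp R ε (Fin a))) M :=
  ⟨0, a, (PairCong.perp_hyp_hyp ε M (finSumFinEquiv.trans (finCongr (Nat.add_zero a))))⟩

/-! ### Forms and their stable classes -/

/-- An invertible symmetric (`ε = 1`) or alternating (`ε = -1`) matrix of size `2 · rank`. -/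
structure Form (ε : ℤˣ) (R : Type*) [CommRing R] where
  /-- half of the size of the matrix -/
  rank : ℕ
  /-- the matrix -/
  mat : Matrix (Fin rank × Fin 2) (Fin rank × Fin 2) R
  isForm : IsForm ε mat

/-- The block sum `A ⊥ B` of matrices of sizes `2m` and `2n`, of size `2(m + n)`. -/
def blockSum {m n : ℕ} (A : Matrix (Fin m × Fin 2) (Fin m × Fin 2) R)
    (B : Matrix (Fin n × Fin 2) (Fin n × Fin 2) R) :
    Matrix (Fin (m + n) × Fin 2) (Fin (m + n) × Fin 2) R :=
  relabel finSumFinEquiv.symm (perp A B)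

/-- `M ∼ N` if there are `i ≥ 1` and `E ∈ E_{2m+2n+2i}(R)` with
`M ⊥ h_{2n+2i} = Eᵀ (N ⊥ h_{2m+2i}) E`, where `h` is `σ` for `ε = 1` and `ψ` for `ε = -1`. -/
def FormRel {ε : ℤˣ} (M N : Form ε R) : Prop :=
  ∃ i : ℕ, 1 ≤ i ∧ ∃ E ∈ elementary (Fin (M.rank + (N.rank + i)) × Fin 2) R,
    blockSum M.mat (hyp R ε (Fin (N.rank + i))) =
      Eᵀ * relabel (finCongr (Nat.add_left_comm M.rank N.rank i))
        (blockSum N.mat (hyp R ε (Fin (M.rank + i)))) * E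

lemma formRel_iff {ε : ℤˣ} (M N : Form ε R) : FormRel M N ↔ Stable ε M.mat N.mat := by
  constructor
  · rintro ⟨i, -, E, hE, h⟩
    refine ⟨N.rank + i, M.rank + i, ?_⟩
    refine (PairCong.of_relabel finSumFinEquiv.symm _).symm.trans ?_
    refine PairCong.trans ⟨finCongr (Nat.add_left_comm M.rank N.rank i), E, hE, h⟩ ?_
    exact PairCong.of_relabel finSumFinEquiv.symm _
  · rintro ⟨a, b, h⟩
    have hab : M.rank + a = N.rank + b := by
      obtain ⟨e, -⟩ := h
      simpa using Fintype.card_congr e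
    refine ⟨a + 1, by omega, ?_⟩
    have h1 : PairCong (perp M.mat (hyp R ε (Fin (N.rank + (a + 1)))))
        (perp N.mat (hyp R ε (Fin (M.rank + (a + 1))))) := by
      refine (PairCong.perp_hyp_hyp ε M.mat (κ := Fin a) (μ := Fin (N.rank + 1))
        (finSumFinEquiv.trans (finCongr (by omega)))).symm.trans ?_
      refine (h.perp_left _).trans ?_
      exact PairCong.perp_hyp_hyp ε N.mat (finSumFinEquiv.trans (finCongr (by omega)))
    have h2 : PairCong (blockSum M.mat (hyp R ε (Fin (N.rank + (a + 1)))))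
        (blockSum N.mat (hyp R ε (Fin (M.rank + (a + 1))))) :=
      (PairCong.of_relabel _ _).trans (h1.trans (PairCong.of_relabel _ _).symm)
    exact h2.elemCong _

instance formSetoid (ε : ℤˣ) (R : Type*) [CommRing R] : Setoid (Form ε R) where
  r := FormRel
  iseqv :=
    { refl := fun M => (formRel_iff M M).mpr (.of_pairCong (.refl _))
      symm := fun h => (formRel_iff _ _).mpr ((formRel_iff _ _).mp h).symm
      trans := fun h h' => (formRel_iff _ _).mpr
        (((formRel_iff _ _).mp h).trans ((formRel_iff _ _).mp h')) }

lemma IsForm.relabel {ε : ℤˣ} {M : Matrix (κ × Fin 2) (κ × Fin 2) R} (h : IsForm ε M)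
    (e : ι ≃ κ) : IsForm ε (relabel e M) := by
  obtain ⟨h1, h2, h3⟩ := h
  refine ⟨(isUnit_submatrix_equiv (e.prodCongr (Equiv.refl (Fin 2)))
    (e.prodCongr (Equiv.refl (Fin 2)))).mpr h1, ?_,
    fun he i => h3 he _⟩
  ext a b
  exact congrFun (congrFun h2 _) _

lemma IsForm.perp {ε : ℤˣ} {M : Matrix (ι × Fin 2) (ι × Fin 2) R}
    {N : Matrix (κ × Fin 2) (κ × Fin 2) R} (h : IsForm ε M) (h' : IsForm ε N) :
    IsForm ε (perp M N) := by
  obtain ⟨h1, h2, h3⟩ := h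
  obtain ⟨h1', h2', h3'⟩ := h'
  refine ⟨(isUnit_submatrix_equiv _ _).mpr (isUnit_fromBlocks_zero₁₂.mpr ⟨h1, h1'⟩), ?_, ?_⟩
  · rw [SpinUnit.perp, transpose_submatrix, fromBlocks_transpose, h2, h2',
      transpose_zero, transpose_zero]
    ext ⟨a | a, i⟩ ⟨b | b, j⟩ <;> simp [Equiv.sumProdDistrib]
  · rintro he ⟨a | a, i⟩
    · exact h3 he _
    · exact h3' he _

lemma isForm_hyp (ε : ℤˣ) : IsForm ε (hyp R ε ι) := by
  have key : (hyp R ε ι) * (hyp R ε ι)ᵀ = 1 := by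
    ext ⟨a, i⟩ ⟨b, j⟩
    have := sgn_mul_self (R := R) ε
    fin_cases i <;> fin_cases j <;>
      simp [hyp, pairDiag, Matrix.mul_apply, Fintype.sum_prod_type, one_apply, this, eq_comm]
  refine ⟨IsUnit.of_mul_eq_one _ key, ?_, ?_⟩
  · ext ⟨a, i⟩ ⟨b, j⟩
    have := sgn_mul_self (R := R) ε
    fin_cases i <;> fin_cases j <;> simp [hyp, pairDiag, this, eq_comm]
  · rintro - ⟨a, i⟩
    fin_cases i <;> simp [hyp, pairDiag]

/-- The block sum of two forms. -/
def Form.add {ε : ℤˣ} (M N : Form ε R) : Form ε R :=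
  ⟨M.rank + N.rank, blockSum M.mat N.mat, (M.isForm.perp N.isForm).relabel _⟩

/-- The hyperbolic form of size `2m`. -/
def Form.hyperbolic (ε : ℤˣ) (R : Type*) [CommRing R] (m : ℕ) : Form ε R :=
  ⟨m, hyp R ε (Fin m), isForm_hyp ε⟩

/-- The swap of the two indices in each pair, `σ_{2m}`. -/
abbrev swapMat (R : Type*) [CommRing R] (ι : Type) [DecidableEq ι] :
    Matrix (ι × Fin 2) (ι × Fin 2) R := hyp R 1 ι

lemma swapMat_mul_self : swapMat R ι * swapMat R ι = 1 := by
  ext ⟨a, i⟩ ⟨b, j⟩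
  fin_cases i <;> fin_cases j <;>
    simp [swapMat, hyp, pairDiag, Matrix.mul_apply, Fintype.sum_prod_type, one_apply, sgn,
      eq_comm]

lemma swapMat_transpose : (swapMat R ι)ᵀ = swapMat R ι := by
  simpa [sgn] using (isForm_hyp (R := R) (ι := ι) 1).2.1

/-- The matrix `-ε s N⁻¹ s`, which represents the inverse of the class of `N`. -/
noncomputable def negMat (ε : ℤˣ) (N : Matrix (ι × Fin 2) (ι × Fin 2) R) :
    Matrix (ι × Fin 2) (ι × Fin 2) R :=
  -(sgn R ε • (swapMat R ι * N⁻¹ * swapMat R ι))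

lemma IsForm.inv_transpose {ε : ℤˣ} {N : Matrix ι ι R} (h : IsForm ε N) :
    (N⁻¹)ᵀ = sgn R ε • N⁻¹ := by
  have hd : IsUnit N.det := (isUnit_iff_isUnit_det _).mp h.1
  rw [transpose_nonsing_inv, h.2.1]
  apply Matrix.inv_eq_left_inv
  rw [smul_mul_smul_comm, sgn_mul_self, one_smul, nonsing_inv_mul _ hd]

lemma diag_eq_zero [Invertible (2 : R)] {N : Matrix ι ι R} (h : Nᵀ = sgn R (-1) • N) (i : ι) :
    N i i = 0 := by
  have := congrFun (congrFun h i) i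
  simp only [transpose_apply, Matrix.smul_apply, sgn, Units.val_neg, Units.val_one, Int.cast_neg,
    Int.cast_one, smul_eq_mul, neg_mul, one_mul] at this
  calc N i i = ⅟2 * (2 * N i i) := by rw [← mul_assoc, invOf_mul_self, one_mul]
    _ = ⅟2 * (N i i + N i i) := by rw [two_mul]
    _ = 0 := by
      nth_rewrite 1 [this]
      simp

lemma negMat_isForm [Invertible (2 : R)] {ε : ℤˣ} {N : Matrix (ι × Fin 2) (ι × Fin 2) R}
    (h : IsForm ε N) : IsForm ε (negMat ε N) := by
  have hs : IsUnit (swapMat R ι) := IsUnit.of_mul_eq_one _ swapMat_mul_self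
  have hi := h.inv_transpose
  have ht : (negMat ε N)ᵀ = sgn R ε • negMat ε N := by
    simp only [negMat, transpose_neg, transpose_smul, transpose_mul, swapMat_transpose, hi,
      Matrix.mul_smul, Matrix.smul_mul, smul_neg, mul_assoc]
  refine ⟨?_, ht, ?_⟩
  · have hn : IsUnit N⁻¹ := (isUnit_nonsing_inv_iff).mpr h.1
    have hm := ((hs.mul hn).mul hs)
    rw [negMat, IsUnit.neg_iff]
    have he : IsUnit (sgn R ε • (1 : Matrix (ι × Fin 2) (ι × Fin 2) R)) :=
      IsUnit.of_mul_eq_one (sgn R ε • 1) (by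
        rw [smul_mul_smul_comm, sgn_mul_self, one_smul, one_mul])
    have := he.mul hm
    rwa [Matrix.smul_mul, one_mul] at this
  · rintro rfl
    exact diag_eq_zero ht

lemma elementary_upper (X : Matrix ι κ R) :
    fromBlocks 1 X 0 1 ∈ elementary (ι ⊕ κ) R := by
  induction X using Matrix.induction_on' with
  | h_zero => simp
  | h_add p q hp hq =>
    have : fromBlocks (1 : Matrix ι ι R) (p + q) 0 (1 : Matrix κ κ R) =
        fromBlocks 1 p 0 1 * fromBlocks 1 q 0 1 := by
      simp [fromBlocks_multiply, add_comm]
    rw [this]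
    exact mul_mem hp hq
  | h_std_basis i j c =>
    refine Submonoid.subset_closure ⟨.inl i, .inr j, c, by simp, ?_⟩
    ext a b
    rcases a with a | a <;> rcases b with b | b <;>
      simp [transvection, single_apply, one_apply]

lemma elementary_lower (Y : Matrix κ ι R) :
    fromBlocks 1 0 Y 1 ∈ elementary (ι ⊕ κ) R := by
  have := elementary_submatrix (Equiv.sumComm ι κ) (elementary_upper Y)
  convert this using 1
  ext a b
  rcases a with a | a <;> rcases b with b | b <;> simp [one_apply]

/-- An even relabelling which takes the standard hyperbolic form to `(0 s; ε s 0)`. -/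
def rotFun : (ι ⊕ ι) × Fin 2 → (ι ⊕ ι) × Fin 2
  | (.inl i, a) => if a = 0 then (.inl i, 0) else (.inr i, 1)
  | (.inr i, a) => if a = 0 then (.inl i, 1) else (.inr i, 0)

lemma rotFun_three (x : (ι ⊕ ι) × Fin 2) : rotFun (rotFun (rotFun x)) = x := by
  rcases x with ⟨i | i, a⟩ <;> fin_cases a <;> simp [rotFun]

/-- The relabelling `rotFun` as a permutation. -/
def rot : Equiv.Perm ((ι ⊕ ι) × Fin 2) :=
  ⟨rotFun, fun x => rotFun (rotFun x), rotFun_three, rotFun_three⟩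

lemma sign_rot : Equiv.Perm.sign (rot (ι := ι)) = 1 := by
  have h : (rot (ι := ι)) * rot * rot = 1 := by
    ext1 x
    exact rotFun_three x
  have := congrArg Equiv.Perm.sign h
  rw [map_mul, map_mul, map_one, Int.units_mul_self, one_mul] at this
  exact this

lemma hyp_rot (ε : ℤˣ) : hyp R ε (ι ⊕ ι) =
    ((fromBlocks 0 (swapMat R ι) (sgn R ε • swapMat R ι) 0).submatrix
      (Equiv.sumProdDistrib ι ι (Fin 2)) (Equiv.sumProdDistrib ι ι (Fin 2))).submatrix
        rot rot := by
  ext ⟨i | i, a⟩ ⟨j | j, b⟩ <;> fin_cases a <;> fin_cases b <;>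
    simp [hyp, pairDiag, rot, rotFun, Equiv.sumProdDistrib, swapMat, sgn]

lemma perp_negMat [Invertible (2 : R)] {ε : ℤˣ} {N : Matrix (ι × Fin 2) (ι × Fin 2) R}
    (h : IsForm ε N) : ElemCong (perp N (negMat ε N)) (hyp R ε (ι ⊕ ι)) := by
  have h0 := elemCong_perm (sign_rot (ι := ι))
    ((fromBlocks 0 (swapMat R ι) (sgn R ε • swapMat R ι) 0).submatrix
      (Equiv.sumProdDistrib ι ι (Fin 2)) (Equiv.sumProdDistrib ι ι (Fin 2)))
  rw [← hyp_rot] at h0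
  refine ElemCong.trans ?_ h0.symm
  refine ElemCong.submatrix _ (ElemCong.symm ?_)
  have hd : IsUnit N.det := (isUnit_iff_isUnit_det _).mp h.1
  have hi := h.inv_transpose
  have h2 := h.2.1
  have hee : sgn R ε * sgn R ε = 1 := sgn_mul_self ε
  set s := swapMat R ι with hs
  have hss : s * s = 1 := swapMat_mul_self
  have hst : sᵀ = s := swapMat_transpose
  have hss' : ∀ P : Matrix (ι × Fin 2) (ι × Fin 2) R, s * (s * P) = P := fun P => by
    rw [← mul_assoc, hss, one_mul]
  have hN : ∀ P : Matrix (ι × Fin 2) (ι × Fin 2) R, N * (N⁻¹ * P) = P := fun P => by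
    rw [← mul_assoc, mul_nonsing_inv _ hd, one_mul]
  have hN' : ∀ P : Matrix (ι × Fin 2) (ι × Fin 2) R, N⁻¹ * (N * P) = P := fun P => by
    rw [← mul_assoc, nonsing_inv_mul _ hd, one_mul]
  refine ⟨fromBlocks 1 (N⁻¹ * s) 0 1 * fromBlocks 1 0 (-(⅟2 : R) • (s * N)) 1,
    mul_mem (elementary_upper _) (elementary_lower _), ?_⟩
  have e1 : (fromBlocks 1 (N⁻¹ * s) 0 1)ᵀ * fromBlocks N 0 0 (negMat ε N) *
      fromBlocks 1 (N⁻¹ * s) 0 1 = fromBlocks N s (sgn R ε • s) 0 := by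
    simp [fromBlocks_transpose, fromBlocks_multiply, negMat, hi, hst, mul_assoc, hN,
      nonsing_inv_mul _ hd, ← hs]
  have e2 : (fromBlocks 1 0 (-(⅟2 : R) • (s * N)) 1)ᵀ * fromBlocks N s (sgn R ε • s) 0 *
     fromBlocks 1 0 (-(⅟2 : R) • (s * N)) 1 = fromBlocks 0 s (sgn R ε • s) 0 := by
    have h3 : (⅟2 : R) • N + (⅟2 : R) • N = N := by
      rw [← add_smul, invOf_two_add_invOf_two, one_smul]
    simp only [fromBlocks_transpose, fromBlocks_multiply, transpose_one, transpose_zero,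
      transpose_smul, transpose_mul, hst, h2, Matrix.mul_smul, Matrix.smul_mul, one_mul, mul_one,
      zero_mul, mul_zero, add_zero, zero_add, mul_assoc, hss, hss', smul_smul]
    congr 1
    have h4 : sgn R ε * (-⅟2 * sgn R ε) = -⅟2 := by
      rw [mul_left_comm, hee, mul_one]
    rw [h4]
    nth_rewrite 1 [← h3]
    simp only [neg_smul]
    abel
  rw [← e2, ← e1]
  simp only [transpose_mul, mul_assoc]

/-- The inverse of a form. -/
noncomputable def Form.neg [Invertible (2 : R)] {ε : ℤˣ} (M : Form ε R) : Form ε R :=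
  ⟨M.rank, negMat ε M.mat, negMat_isForm M.isForm⟩

/-- The group of stable classes of forms under the block sum: `S(R)/∼` for `ε = 1` and
`W'_E(R) = A(R)/∼` for `ε = -1`. -/
def Witt (ε : ℤˣ) (R : Type*) [CommRing R] : Type _ := Quotient (formSetoid ε R)

/-- The class of a form. -/
def Witt.mk {ε : ℤˣ} (M : Form ε R) : Witt ε R := Quotient.mk _ M

lemma Form.add_stable {ε : ℤˣ} (M N : Form ε R) :
    PairCong (M.add N).mat (perp M.mat N.mat) :=
  .of_relabel _ _

lemma Witt.mk_eq {ε : ℤˣ} {M N : Form ε R} : Witt.mk M = Witt.mk N ↔ Stable ε M.mat N.mat :=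
  Quotient.eq.trans (formRel_iff M N)

lemma Stable.absorb {ε : ℤˣ} (M : Matrix (ι × Fin 2) (ι × Fin 2) R)
    {H : Matrix (κ × Fin 2) (κ × Fin 2) R} (h : PairCong H (hyp R ε κ)) :
    Stable ε (perp M H) M := by
  refine Stable.trans (Stable.of_pairCong ((PairCong.refl M).perp_congr (h.trans
    (PairCong.hyp ε (Fintype.equivFin κ))))) (Stable.perp_hyp M _)

lemma Stable.hyp (ε : ℤˣ) : Stable ε (hyp R ε ι) (SpinUnit.hyp R ε κ) := by
  refine ⟨Fintype.card κ, Fintype.card ι, ?_⟩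
  rw [SpinUnit.perp_hyp, SpinUnit.perp_hyp]
  exact .hyp ε (((Fintype.equivFin ι).sumCongr (Fintype.equivFin κ).symm).trans
    (Equiv.sumComm _ _))

lemma pairCong_negMat [Invertible (2 : R)] {ε : ℤˣ} {N : Matrix (ι × Fin 2) (ι × Fin 2) R}
    (h : IsForm ε N) : PairCong (perp N (negMat ε N)) (hyp R ε (ι ⊕ ι)) :=
  ⟨Equiv.refl _, perp_negMat h⟩

lemma negMat_stable [Invertible (2 : R)] {ε : ℤˣ} {M : Matrix (ι × Fin 2) (ι × Fin 2) R}
    {N : Matrix (κ × Fin 2) (κ × Fin 2) R} (hM : IsForm ε M) (hN : IsForm ε N)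
    (h : Stable ε M N) : Stable ε (negMat ε M) (negMat ε N) := by
  have h1 : Stable ε (perp (negMat ε M) (perp N (negMat ε N))) (negMat ε M) :=
    (Stable.absorb _ ((pairCong_negMat hN)))
  have h2 : Stable ε (perp (negMat ε N) (perp M (negMat ε M))) (negMat ε N) :=
    (Stable.absorb _ ((pairCong_negMat hM)))
  refine h1.symm.trans (Stable.trans ?_ h2)
  refine (Stable.of_pairCong (.perp_comm _ _)).trans ?_
  refine Stable.trans ?_ (Stable.of_pairCong (.perp_comm _ _))
  refine Stable.trans ((h.symm.perp_left _).perp_left _) (Stable.of_pairCong ?_)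
  exact .perp_right_comm _ _ _

/-- Addition is induced by the block sum. -/
instance (ε : ℤˣ) : Add (Witt ε R) where
  add := Quotient.map₂ Form.add fun M M' h N N' h' => (formRel_iff _ _).mpr <|
    (Stable.of_pairCong (Form.add_stable M N)).trans <|
    (((formRel_iff _ _).mp h).perp_congr ((formRel_iff _ _).mp h')).trans
      (Stable.of_pairCong (Form.add_stable M' N')).symm

/-- The neutral element is the class of the hyperbolic form of size `2`. -/
instance (ε : ℤˣ) : Zero (Witt ε R) := ⟨Witt.mk (Form.hyperbolic ε R 1)⟩

noncomputable instance [Invertible (2 : R)] (ε : ℤˣ) : Neg (Witt ε R) where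
  neg := Quotient.map Form.neg fun M M' h => (formRel_iff _ _).mpr
    (negMat_stable M.isForm M'.isForm ((formRel_iff _ _).mp h))

noncomputable instance [Invertible (2 : R)] (ε : ℤˣ) : AddCommGroup (Witt ε R) where
  nsmul := nsmulRec
  zsmul := zsmulRec
  add_assoc := by
    rintro ⟨M⟩ ⟨N⟩ ⟨P⟩
    refine Witt.mk_eq.mpr (Stable.of_pairCong ?_)
    refine (Form.add_stable (M.add N) P).trans ?_
    refine ((Form.add_stable M N).perp_left _).trans ?_
    refine (PairCong.perp_assoc _ _ _).trans ?_
    refine PairCong.trans ?_ (Form.add_stable M (N.add P)).symm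
    exact (PairCong.refl _).perp_congr (Form.add_stable N P).symm
  add_comm := by
    rintro ⟨M⟩ ⟨N⟩
    refine Witt.mk_eq.mpr (Stable.of_pairCong ?_)
    exact (Form.add_stable M N).trans
      ((PairCong.perp_comm _ _).trans (Form.add_stable N M).symm)
  zero_add := by
    rintro ⟨M⟩
    refine Witt.mk_eq.mpr ?_
    exact (Stable.of_pairCong ((Form.add_stable _ M).trans (PairCong.perp_comm _ _))).trans
      (Stable.perp_hyp _ _)
  add_zero := by
    rintro ⟨M⟩
    refine Witt.mk_eq.mpr ?_
    exact (Stable.of_pairCong (Form.add_stable M _)).trans (Stable.perp_hyp _ _)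
  neg_add_cancel := by
    rintro ⟨M⟩
    refine Witt.mk_eq.mpr ?_
    refine (Stable.of_pairCong ((Form.add_stable M.neg M).trans ((PairCong.perp_comm _ _).trans
      (pairCong_negMat M.isForm)))).trans ?_
    exact Stable.hyp ε

/-- The form `Mᵀ h M` for an invertible matrix `M` of size `2m`, where `h` is the hyperbolic form
of size `2m`. -/
def Form.hyperbolicOf [Invertible (2 : R)] (ε : ℤˣ) {m : ℕ} (M : GL (Fin m × Fin 2) R) :
    Form ε R where
  rank := m
  mat := M.valᵀ * hyp R ε (Fin m) * M.val
  isForm := by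
    obtain ⟨h1, h2, -⟩ := isForm_hyp (R := R) (ι := Fin m) ε
    have ht : (M.valᵀ * hyp R ε (Fin m) * M.val)ᵀ =
        sgn R ε • (M.valᵀ * hyp R ε (Fin m) * M.val) := by
      rw [transpose_mul, transpose_mul, transpose_transpose, h2]
      simp [mul_assoc]
    refine ⟨(((isUnit_transpose _).mpr M.isUnit).mul h1).mul M.isUnit, ht, ?_⟩
    rintro rfl
    exact diag_eq_zero ht

/-- The image of the hyperbolic homomorphism `K₁(R) → Witt ε R`, `[M] ↦ [Mᵀ h M]`. Since `K₁(R)`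
is generated by the classes of invertible matrices of even size, this is the subgroup generated by
the classes of all `Mᵀ h M`. -/
noncomputable def hyperbolicImage [Invertible (2 : R)] (ε : ℤˣ) : AddSubgroup (Witt ε R) :=
  AddSubgroup.closure {x | ∃ (m : ℕ) (M : GL (Fin m × Fin 2) R),
    x = Witt.mk (Form.hyperbolicOf ε M)}

/-- The cokernel of the hyperbolic homomorphism `K₁(R) → Witt ε R`. -/
abbrev Coker (ε : ℤˣ) (R : Type*) [CommRing R] [Invertible (2 : R)] : Type _ :=
  Witt ε R ⧸ hyperbolicImage (R := R) ε

/-! ### Unimodular vectors, unit vectors and the Spin group -/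

/-- Unimodular vectors of length `n`: the entries generate the unit ideal. -/
abbrev Um (n : ℕ) (R : Type*) [CommRing R] : Type _ :=
  {a : Fin n → R // Ideal.span (Set.range a) = ⊤}

/-- Unit vectors: pairs `(a, b)` with `∑ aᵢ bᵢ = 1`. -/
abbrev UnitVec (n : ℕ) (R : Type*) [CommRing R] : Type _ :=
  {x : (Fin n → R) × (Fin n → R) // ∑ i, x.1 i * x.2 i = 1}

/-- The unimodular vector `a` underlying a unit vector `(a, b)`. -/
def UnitVec.fst {n : ℕ} (x : UnitVec n R) : Um n R :=
  ⟨x.1.1, (Ideal.eq_top_iff_one _).mpr (by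
    have h : ∑ i, x.1.1 i * x.1.2 i ∈ Ideal.span (Set.range x.1.1) := Ideal.sum_mem _ fun i _ =>
      Ideal.mul_mem_right _ _ (Ideal.subset_span (Set.mem_range_self i))
    rwa [x.2] at h)⟩

/-- The orbit relation of `SL_n(R)` on `Um_n(R)`. -/
def slSetoid (n : ℕ) (R : Type*) [CommRing R] : Setoid (Um n R) where
  r v w := ∃ g : SpecialLinearGroup (Fin n) R, (g : Matrix (Fin n) (Fin n) R) *ᵥ v.val = w.val
  iseqv :=
    { refl := fun v => ⟨1, by simp⟩
      symm := by
        rintro v w ⟨g, h⟩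
        refine ⟨g⁻¹, ?_⟩
        have hg : (g⁻¹ : SpecialLinearGroup (Fin n) R).1 * g.1 = 1 :=
          congrArg Subtype.val (inv_mul_cancel g)
        rw [← h, mulVec_mulVec, hg, one_mulVec]
      trans := by
        rintro u v w ⟨g, h⟩ ⟨g', h'⟩
        refine ⟨g' * g, ?_⟩
        have hg : (g' * g : SpecialLinearGroup (Fin n) R).1 = g'.1 * g.1 := rfl
        rw [hg, ← mulVec_mulVec, h, h'] }

/-- The orbit space `Um_n(R)/SL_n(R)`. -/
abbrev UmModSL (n : ℕ) (R : Type*) [CommRing R] : Type _ := Quotient (slSetoid n R)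

/-- The hyperbolic quadratic form `q(a, b) = ∑ aᵢ bᵢ` on `Rⁿ ⊕ Rⁿ`. -/
def quadForm (n : ℕ) (R : Type*) [CommRing R] :
    QuadraticForm R ((Fin n → R) × (Fin n → R)) :=
  ∑ i, QuadraticMap.linMulLin (LinearMap.proj i ∘ₗ LinearMap.fst R (Fin n → R) (Fin n → R))
    (LinearMap.proj i ∘ₗ LinearMap.snd R (Fin n → R) (Fin n → R))

lemma quadForm_apply (n : ℕ) (x : (Fin n → R) × (Fin n → R)) :
    quadForm n R x = ∑ i, x.1 i * x.2 i := by
  simp [quadForm]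

/-- The Clifford algebra of the hyperbolic space `Rⁿ ⊕ Rⁿ`. -/
abbrev Cl (n : ℕ) (R : Type*) [CommRing R] : Type _ := CliffordAlgebra (quadForm n R)

/-- The group `Spin_{2n}(R)`: all `g` in the even part of the Clifford algebra with
`g g* = 1` and `g (Rⁿ ⊕ Rⁿ) g⁻¹ = Rⁿ ⊕ Rⁿ`, where `*` is the standard involution (which is `-1`
on vectors). -/
def spin (n : ℕ) (R : Type*) [CommRing R] : Subgroup (Cl n R)ˣ where
  carrier := {g | g.val ∈ CliffordAlgebra.evenOdd (quadForm n R) 0 ∧ g.val * star g.val = 1 ∧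
    (fun x => g.val * x * g⁻¹.val) '' Set.range (CliffordAlgebra.ι (quadForm n R)) =
      Set.range (CliffordAlgebra.ι (quadForm n R))}
  mul_mem' := by
    rintro g h ⟨g1, g2, g3⟩ ⟨h1, h2, h3⟩
    refine ⟨?_, ?_, ?_⟩
    · have := SetLike.mul_mem_graded g1 h1
      simpa using this
    · rw [Units.val_mul, star_mul, mul_assoc, ← mul_assoc h.val, h2, one_mul, g2]
    · conv_rhs => rw [← g3, ← h3]
      rw [Set.image_image]
      simp [mul_assoc]
  one_mem' := ⟨SetLike.one_mem_graded _, by simp, by simp⟩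
  inv_mem' := by
    rintro g ⟨g1, g2, g3⟩
    have hs : g⁻¹.val = star g.val := by
      rw [← one_mul (star g.val), ← g.inv_mul, mul_assoc, g2, mul_one]
    have hs' : star g⁻¹.val = g.val := by rw [hs, star_star]
    refine ⟨?_, ?_, ?_⟩
    · rw [hs, CliffordAlgebra.star_def]
      exact (CliffordAlgebra.reverse_mem_evenOdd_iff _).mpr
        ((CliffordAlgebra.involute_mem_evenOdd_iff _).mpr g1)
    · rw [hs', g.inv_mul]
    · conv_lhs => rw [← g3]
      rw [Set.image_image]
      simp [mul_assoc]

/-- The orbit relation of `Spin_{2n}(R)` on unit vectors, where `g` acts by `x ↦ g x g⁻¹`. -/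
def spinSetoid (n : ℕ) (R : Type*) [CommRing R] : Setoid (UnitVec n R) where
  r x y := ∃ g ∈ spin n R, g.val * CliffordAlgebra.ι (quadForm n R) x.val * g⁻¹.val =
    CliffordAlgebra.ι (quadForm n R) y.val
  iseqv :=
    { refl := fun x => ⟨1, one_mem _, by simp⟩
      symm := by
        rintro x y ⟨g, hg, h⟩
        refine ⟨g⁻¹, inv_mem hg, ?_⟩
        rw [← h]
        simp [mul_assoc]
      trans := by
        rintro x y z ⟨g, hg, h⟩ ⟨g', hg', h'⟩
        refine ⟨g' * g, mul_mem hg' hg, ?_⟩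
        rw [← h', ← h]
        simp [mul_assoc] }

/-- The orbit space `U_{2n-1}(R)/Spin_{2n}(R)`. -/
abbrev UnitVecModSpin (n : ℕ) (R : Type*) [CommRing R] : Type _ := Quotient (spinSetoid n R)

/-! ### Suslin matrices and the degree map -/

/-- The block matrix `(A B; C D)` of size `2^{n+1}` with blocks of size `2^n`. -/
def blk {n : ℕ} (A B C D : Matrix (Fin (2 ^ n)) (Fin (2 ^ n)) R) :
    Matrix (Fin (2 ^ (n + 1))) (Fin (2 ^ (n + 1))) R :=
  reindex (finSumFinEquiv.trans (finCongr (by rw [pow_succ, mul_two])))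
    (finSumFinEquiv.trans (finCongr (by rw [pow_succ, mul_two]))) (fromBlocks A B C D)

/-- The Suslin matrix `α_n(a, b)` of size `2^{n-1}`, for `n ≥ 1` (the value at `n = 0` is not
used). -/
def suslin : (n : ℕ) → (a b : Fin n → R) → Matrix (Fin (2 ^ (n - 1))) (Fin (2 ^ (n - 1))) R
  | 0, _, _ => 1
  | 1, a, _ => fun _ _ => a 0
  | n + 2, a, b =>
    blk (n := n) (a 0 • 1) (suslin (n + 1) (Fin.tail a) (Fin.tail b))
      (-(suslin (n + 1) (Fin.tail b) (Fin.tail a))ᵀ) (b 0 • 1)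

/-- The matrix `J_n` of size `2^{n-1}`, for `n ≥ 1` (the value at `n = 0` is not used). -/
def matJ (R : Type*) [CommRing R] :
    (n : ℕ) → Matrix (Fin (2 ^ (n - 1))) (Fin (2 ^ (n - 1))) R
  | 0 => 1
  | 1 => 1
  | n + 2 =>
    if (n + 2) % 2 = 0 then blk (n := n) 0 (matJ R (n + 1)) (-matJ R (n + 1)) 0
    else blk (n := n) (matJ R (n + 1)) 0 0 (-matJ R (n + 1))

/-- The identification of `Fin (2^{m+1})` with `Fin (2^m) × Fin 2`, `j + 2 i ↔ (i, j)`. -/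
def pairEquiv (m : ℕ) : Fin (2 ^ m) × Fin 2 ≃ Fin (2 ^ (m + 1)) :=
  finProdFinEquiv.trans (finCongr (pow_succ 2 m).symm)

/-- The block diagonal matrix of size `2^{m+1}` with all diagonal blocks equal to `B`. -/
def diagPow (m : ℕ) (B : Matrix (Fin 2) (Fin 2) R) :
    Matrix (Fin (2 ^ (m + 1))) (Fin (2 ^ (m + 1))) R :=
  reindex (pairEquiv m) (pairEquiv m) (pairDiag (Fin (2 ^ m)) B)

/-- The matrix `E_n` of size `2^{n-1}`, for `n ≥ 1` (the value at `n = 0` is not used). Here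
`σ`, `ψ`, `τ` are the matrices of size `2^{n-2}` with diagonal blocks
`(0 1; 1 0)`, `(0 1; -1 0)`, `(0 1; 0 0)`. -/
def matE (R : Type*) [CommRing R] :
    (n : ℕ) → Matrix (Fin (2 ^ (n - 1))) (Fin (2 ^ (n - 1))) R
  | 0 => 1
  | 1 => 1
  | 2 => 1
  | m + 3 =>
    let σ : Matrix (Fin (2 ^ (m + 1))) (Fin (2 ^ (m + 1))) R := diagPow m !![0, 1; 1, 0]
    let ψ : Matrix (Fin (2 ^ (m + 1))) (Fin (2 ^ (m + 1))) R := diagPow m !![0, 1; -1, 0]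
    let τ : Matrix (Fin (2 ^ (m + 1))) (Fin (2 ^ (m + 1))) R := diagPow m !![0, 1; 0, 0]
    if (m + 3) % 4 = 0 then
      blk (n := m + 1) 1 0 0 (matJ R (m + 2))ᵀ * blk 1 0 τ 1 * blk 1 (-σ) 0 1 * blk 1 0 0 ψ
    else if (m + 3) % 4 = 1 then
      blk (n := m + 1) (matE R (m + 2)) 0 0 (matE R (m + 2)) * blk 1 0 0 ψ
    else if (m + 3) % 4 = 2 then
      blk (n := m + 1) 1 0 0 (matJ R (m + 2))ᵀ * blk 1 0 τ 1 * blk 1 ψ 0 1 * blk 1 0 0 σ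
    else
      blk (n := m + 1) (matE R (m + 2)) 0 0 (matE R (m + 2)) * blk 1 0 0 σ

/-- The matrix `Ψ_n(a, b) = E_nᵀ α_n(a, b) J_n E_n` of size `2^{n-1}`, for odd `n`, with its
index set `Fin (2^{n-1})` written as `Fin (2^{n-2}) × Fin 2`. -/
def degMat {n : ℕ} (hn : 3 ≤ n) (x : UnitVec n R) :
    Matrix (Fin (2 ^ (n - 2)) × Fin 2) (Fin (2 ^ (n - 2)) × Fin 2) R :=
  let e : Fin (2 ^ (n - 2)) × Fin 2 ≃ Fin (2 ^ (n - 1)) :=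
    finProdFinEquiv.trans (finCongr (by rw [← pow_succ]; congr 1; omega))
  ((matE R n)ᵀ * suslin n x.val.1 x.val.2 * matJ R n * matE R n).submatrix e e

/-- For odd `n`: symmetric forms (`1`) if `n ≡ 1 mod 4` and alternating forms (`-1`) if
`n ≡ 3 mod 4`. -/
def degSign (n : ℕ) : ℤˣ := if n % 4 = 1 then 1 else -1

/-- `c : Um_n(R)/SL_n(R) → U_{2n-1}(R)/Spin_{2n}(R)` is the comparison map: it sends the orbit
of `a` to the orbit of `(a, b)` for every `b` with `∑ aᵢ bᵢ = 1`. -/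
def IsComparisonMap {n : ℕ} (c : UmModSL n R → UnitVecModSpin n R) : Prop :=
  ∀ x : UnitVec n R, c (Quotient.mk _ x.fst) = Quotient.mk _ x

/-- `d : U_{2n-1}(R)/Spin_{2n}(R) → coker(K₁(R) → Witt ε R)` is the map induced by `Ψ_n`: the
matrix `Ψ_n(a, b)` is always invertible symmetric (respectively alternating), and `d` sends the
orbit of `(a, b)` to the class of `Ψ_n(a, b)`. -/
def IsDegreeMap [Invertible (2 : R)] {n : ℕ} (hn : 3 ≤ n)
    (d : UnitVecModSpin n R → Coker (degSign n) R) : Prop :=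
  ∀ x : UnitVec n R, ∃ h : IsForm (degSign n) (degMat hn x),
    d (Quotient.mk _ x) = QuotientAddGroup.mk (Witt.mk ⟨2 ^ (n - 2), degMat hn x, h⟩)

end SpinUnit

/-!
The comparison map is well defined because of two facts about `Spin_{2n}(R)`. Two unit vectors
`(a, b)` and `(a, c)` with the same first component are joined by the unipotent element
`1 + f_{c-b} f_b` of the Clifford algebra, where `f_v` is the vector `(0, v)`
(`exists_spin_of_fst_eq`). And each `g ∈ SL_n(R)`, acting by `(a, b) ↦ (g a, g⁻ᵀ b)`, lifts to the
Spin group (`exists_spin_of_det_eq_one`). For the lift, let `p = f_1 ⋯ f_n` be the volume element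
of the second summand of `Rⁿ ⊕ Rⁿ`. It generates the unit ideal of the Clifford algebra `A`, so that
`1 = ∑ xᵢ p yᵢ`, and `p A p = R p`. The automorphism `θ` of `A` induced by `g` multiplies `p` by
`det g⁻ᵀ = 1`, so it fixes `p A p` pointwise, and this makes `θ` the conjugation by
`T = ∑ θ(xᵢ) p yᵢ`. Moreover `T p = p = p T`, which forces `T T* = 1`
(`exists_unitary_of_fixes_corner`).

For the degree map, the Suslin matrices satisfy `S(a, b) S(b, a)ᵀ = (a ⬝ b) 1`, hence give a
representation of the Clifford algebra by block matrices, in which even elements are block diagonal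
(`suslinRep_even`). For odd `n` the identities `S J = J Sᵀ` and `Jᵀ = ± J` show that `S J`, and
hence `Ψ_n = Eᵀ S J E`, is symmetric or alternating, and that the standard involution becomes the
adjoint involution of `(0 J; -J 0)` (`suslinRep_star`). An element of the Spin group therefore has
an upper left block `G` with `S(y) J = G (S(x) J) Gᵀ` when it takes `x` to `y`
(`exists_sus_congr`). Of `E_n` only the invertibility matters: `Ψ_n(x)` and `Ψ_n(y)` are congruent
under `GL`, and congruent forms agree in the cokernel of the hyperbolic map
(`coker_mk_eq_of_congr`).

The comparison map is surjective because every unit vector `(a, b)` lies over `a`; so it is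
bijective as soon as it is injective, in particular when its composite with the degree map is.
-/

namespace SpinUnit

open Matrix

/-! ### Fermionic calculus in the Clifford algebra of the hyperbolic space -/

section Fermion

variable {R : Type*} [CommRing R] {n : ℕ}

lemma polar_quadForm (x y : (Fin n → R) × (Fin n → R)) :
    QuadraticMap.polar (quadForm n R) x y = x.1 ⬝ᵥ y.2 + y.1 ⬝ᵥ x.2 := by
  simp only [QuadraticMap.polar, quadForm_apply, dotProduct, Prod.fst_add, Prod.snd_add,
    Pi.add_apply, ← Finset.sum_add_distrib, ← Finset.sum_sub_distrib]
  exact Finset.sum_congr rfl fun i _ => by ring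

/-- The isotropic vector `(e_k, 0)` in the Clifford algebra; it is `0` for `k ≥ n`. -/
def gE (n : ℕ) (R : Type*) [CommRing R] (k : ℕ) : Cl n R :=
  CliffordAlgebra.ι (quadForm n R) (fun j => if j.val = k then 1 else 0, 0)

/-- The isotropic vector `(0, e_k)` in the Clifford algebra; it is `0` for `k ≥ n`. -/
def gF (n : ℕ) (R : Type*) [CommRing R] (k : ℕ) : Cl n R :=
  CliffordAlgebra.ι (quadForm n R) (0, fun j => if j.val = k then 1 else 0)

lemma gE_mul_gE (i j : ℕ) : gE n R i * gE n R j = -(gE n R j * gE n R i) := by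
  rw [gE, gE, CliffordAlgebra.ι_mul_ι_comm, polar_quadForm]
  simp

lemma gF_mul_gF (i j : ℕ) : gF n R i * gF n R j = -(gF n R j * gF n R i) := by
  rw [gF, gF, CliffordAlgebra.ι_mul_ι_comm, polar_quadForm]
  simp

lemma gE_mul_self (i : ℕ) : gE n R i * gE n R i = 0 := by
  rw [gE, CliffordAlgebra.ι_sq_scalar, quadForm_apply]
  simp

lemma gF_mul_self (i : ℕ) : gF n R i * gF n R i = 0 := by
  rw [gF, CliffordAlgebra.ι_sq_scalar, quadForm_apply]
  simp

lemma gE_mul_gF_of_ne {i j : ℕ} (h : i ≠ j) :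
    gE n R i * gF n R j = -(gF n R j * gE n R i) := by
  rw [gE, gF, CliffordAlgebra.ι_mul_ι_comm, polar_quadForm]
  have : ((fun l : Fin n => if l.val = i then (1 : R) else 0) ⬝ᵥ
      fun l => if l.val = j then 1 else 0) = 0 := by
    refine Finset.sum_eq_zero fun l _ => ?_
    by_cases h1 : l.val = i
    · simp [h1, h]
    · simp [h1]
  simp [this]

lemma gE_mul_gF_self {k : ℕ} (h : k < n) :
    gE n R k * gF n R k = 1 - gF n R k * gE n R k := by
  rw [gE, gF, CliffordAlgebra.ι_mul_ι_comm, polar_quadForm]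
  have : ((fun l : Fin n => if l.val = k then (1 : R) else 0) ⬝ᵥ
      fun l => if l.val = k then 1 else 0) = 1 := by
    rw [dotProduct, Finset.sum_eq_single ⟨k, h⟩]
    · simp
    · intro b _ hb
      have : b.val ≠ k := fun h' => hb (Fin.ext h')
      simp [this]
    · simp
  simp [this]

lemma involute_gE (k : ℕ) : CliffordAlgebra.involute (gE n R k) = -gE n R k := by
  rw [gE, CliffordAlgebra.involute_ι]

lemma involute_gF (k : ℕ) : CliffordAlgebra.involute (gF n R k) = -gF n R k := by
  rw [gF, CliffordAlgebra.involute_ι]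

lemma star_gF (k : ℕ) : star (gF n R k) = -gF n R k := by
  rw [gF, CliffordAlgebra.star_ι]

/-- The product `f_0 f_1 ⋯ f_{k-1}`, a volume element of an isotropic subspace. -/
def gP (n : ℕ) (R : Type*) [CommRing R] : ℕ → Cl n R
  | 0 => 1
  | k + 1 => gP n R k * gF n R k

lemma gF_mul_gP {k j : ℕ} : gF n R j * gP n R k = (-1 : R) ^ k • (gP n R k * gF n R j) := by
  induction k with
  | zero => simp [gP]
  | succ k ih =>
    rw [gP, ← mul_assoc, ih, smul_mul_assoc, mul_assoc, gF_mul_gF, mul_neg, mul_assoc, pow_succ,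
      mul_neg_one, neg_smul, smul_neg]

lemma gE_mul_gP {k j : ℕ} (h : k ≤ j) :
    gE n R j * gP n R k = (-1 : R) ^ k • (gP n R k * gE n R j) := by
  induction k with
  | zero => simp [gP]
  | succ k ih =>
    rw [gP, ← mul_assoc, ih (by omega), smul_mul_assoc, mul_assoc, gE_mul_gF_of_ne (by omega),
      mul_neg, mul_assoc, pow_succ, mul_neg_one, neg_smul, smul_neg]

lemma smul_sign_involutive {A : Type*} [AddCommGroup A] [Module R A] (k : ℕ) (x : A) :
    (-1 : R) ^ k • (-1 : R) ^ k • x = x := by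
  rw [smul_smul, ← mul_pow]
  simp

lemma gP_mul_gF {k j : ℕ} : gP n R k * gF n R j = (-1 : R) ^ k • (gF n R j * gP n R k) := by
  rw [gF_mul_gP, smul_sign_involutive]

lemma gP_mul_gE {k j : ℕ} (h : k ≤ j) :
    gP n R k * gE n R j = (-1 : R) ^ k • (gE n R j * gP n R k) := by
  rw [gE_mul_gP h, smul_sign_involutive]

lemma involute_gP (k : ℕ) : CliffordAlgebra.involute (gP n R k) = gP n R k ∨
    CliffordAlgebra.involute (gP n R k) = -gP n R k := by
  induction k with
  | zero => left; simp [gP]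
  | succ k ih => rcases ih with h | h <;> simp [gP, h, involute_gF]

lemma star_gP (k : ℕ) : star (gP n R k) = gP n R k ∨ star (gP n R k) = -gP n R k := by
  induction k with
  | zero => left; simp [gP]
  | succ k ih =>
    rcases ih with h | h <;> rcases neg_one_pow_eq_or R k with h' | h' <;>
      simp [gP, h, star_gF, gF_mul_gP, h']

/-- The two-sided ideal generated by the volume element is the whole algebra. -/
lemma exists_sum_mul_gP_mul {k : ℕ} (hk : k ≤ n) :
    ∃ (s : Type) (_ : Fintype s) (x y : s → Cl n R), ∑ i, x i * gP n R k * y i = 1 := by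
  induction k with
  | zero => exact ⟨Unit, inferInstance, fun _ => 1, fun _ => 1, by simp [gP]⟩
  | succ k ih =>
    obtain ⟨s, _, x, y, h⟩ := ih (by omega)
    refine ⟨s ⊕ s, inferInstance, Sum.elim x (fun i => (-1 : R) ^ k • (x i * gE n R k)),
      Sum.elim (fun i => gE n R k * y i) y, ?_⟩
    rw [Fintype.sum_sum_type, ← h, ← Finset.sum_add_distrib]
    refine Finset.sum_congr rfl fun i _ => ?_
    have h1 := gE_mul_gF_self (R := R) (show k < n by omega)
    have h2 : gP n R k = gP n R k * gF n R k * gE n R k +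
        (-1 : R) ^ k • (gE n R k * (gP n R k * gF n R k)) := by
      rw [← mul_assoc (gE n R k), ← smul_mul_assoc, ← gP_mul_gE le_rfl, mul_assoc, mul_assoc, h1]
      simp [mul_sub]
    conv_rhs => rw [h2]
    simp only [Sum.elim_inl, Sum.elim_inr, gP]
    simp only [mul_add, add_mul, smul_mul_assoc, mul_smul_comm, mul_assoc]

/-- The subalgebra generated by the vectors supported on the coordinates `≥ k`. -/
def tailAlg (n : ℕ) (R : Type*) [CommRing R] (k : ℕ) : Subalgebra R (Cl n R) :=
  Algebra.adjoin R {z | ∃ j, k ≤ j ∧ (z = gE n R j ∨ z = gF n R j)}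

lemma gE_mem_tailAlg {k j : ℕ} (h : k ≤ j) : gE n R j ∈ tailAlg n R k :=
  Algebra.subset_adjoin ⟨j, h, .inl rfl⟩

lemma gF_mem_tailAlg {k j : ℕ} (h : k ≤ j) : gF n R j ∈ tailAlg n R k :=
  Algebra.subset_adjoin ⟨j, h, .inr rfl⟩

lemma involute_mem_tailAlg {k : ℕ} {b : Cl n R} (hb : b ∈ tailAlg n R k) :
    CliffordAlgebra.involute b ∈ tailAlg n R k := by
  induction hb using Algebra.adjoin_induction with
  | mem x hx =>
    obtain ⟨j, h, rfl | rfl⟩ := hx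
    · rw [involute_gE]; exact neg_mem (gE_mem_tailAlg h)
    · rw [involute_gF]; exact neg_mem (gF_mem_tailAlg h)
  | algebraMap r => rw [AlgHom.commutes]; exact Subalgebra.algebraMap_mem _ r
  | add x y _ _ hx hy => rw [map_add]; exact add_mem hx hy
  | mul x y _ _ hx hy => rw [map_mul]; exact mul_mem hx hy

lemma gF_mul_of_mem_tailAlg {k j : ℕ} (hj : j < k) {b : Cl n R} (hb : b ∈ tailAlg n R k) :
    gF n R j * b = CliffordAlgebra.involute b * gF n R j := by
  induction hb using Algebra.adjoin_induction with
  | mem x hx =>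
    obtain ⟨i, h, rfl | rfl⟩ := hx
    · rw [involute_gE, neg_mul, gE_mul_gF_of_ne (by omega), neg_neg]
    · rw [involute_gF, neg_mul, gF_mul_gF]
  | algebraMap r => rw [AlgHom.commutes, Algebra.commutes]
  | add x y _ _ hx hy => rw [map_add, mul_add, add_mul, hx, hy]
  | mul x y _ _ hx hy => rw [map_mul, ← mul_assoc, hx, mul_assoc, hy, mul_assoc]

lemma gE_mul_of_mem_tailAlg {k j : ℕ} (hj : j < k) {b : Cl n R} (hb : b ∈ tailAlg n R k) :
    gE n R j * b = CliffordAlgebra.involute b * gE n R j := by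
  induction hb using Algebra.adjoin_induction with
  | mem x hx =>
    obtain ⟨i, h, rfl | rfl⟩ := hx
    · rw [involute_gE, neg_mul, gE_mul_gE]
    · rw [involute_gF, neg_mul, gE_mul_gF_of_ne (by omega)]
  | algebraMap r => rw [AlgHom.commutes, Algebra.commutes]
  | add x y _ _ hx hy => rw [map_add, mul_add, add_mul, hx, hy]
  | mul x y _ _ hx hy => rw [map_mul, ← mul_assoc, hx, mul_assoc, hy, mul_assoc]

/-- As a left module over the algebra of the coordinates `> k`, the left ideal generated by `f_k`
is spanned by `f_k` and `e_k f_k`. -/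
lemma mul_gF_of_mem_tailAlg {k : ℕ} (hk : k < n) {b : Cl n R} (hb : b ∈ tailAlg n R k) :
    ∃ c ∈ tailAlg n R (k + 1), ∃ d ∈ tailAlg n R (k + 1),
      b * gF n R k = c * gF n R k + d * (gE n R k * gF n R k) := by
  suffices H : ∀ m : Cl n R, (∃ c ∈ tailAlg n R (k + 1), ∃ d ∈ tailAlg n R (k + 1),
        m = c * gF n R k + d * (gE n R k * gF n R k)) →
      ∃ c ∈ tailAlg n R (k + 1), ∃ d ∈ tailAlg n R (k + 1),
        b * m = c * gF n R k + d * (gE n R k * gF n R k) from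
    H _ ⟨1, one_mem _, 0, zero_mem _, by simp⟩
  induction hb using Algebra.adjoin_induction with
  | mem x hx =>
    rintro _ ⟨c, hc, d, hd, rfl⟩
    obtain ⟨j, h, hx⟩ := hx
    rcases h.eq_or_lt with rfl | h
    · rcases hx with rfl | rfl
      · refine ⟨0, zero_mem _, _, involute_mem_tailAlg hc, ?_⟩
        rw [mul_add, ← mul_assoc, ← mul_assoc, gE_mul_of_mem_tailAlg k.lt_succ_self hc,
          gE_mul_of_mem_tailAlg k.lt_succ_self hd, mul_assoc _ (gE n R k) (gE n R k * _),
          ← mul_assoc (gE n R k) (gE n R k), gE_mul_self]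
        simp [mul_assoc]
      · refine ⟨_, involute_mem_tailAlg hd, 0, zero_mem _, ?_⟩
        rw [mul_add, ← mul_assoc, ← mul_assoc, gF_mul_of_mem_tailAlg k.lt_succ_self hc,
          gF_mul_of_mem_tailAlg k.lt_succ_self hd, mul_assoc _ (gF n R k) (gF n R k),
          gF_mul_self, mul_assoc _ (gF n R k) (gE n R k * _), gE_mul_gF_self hk, mul_sub,
          ← mul_assoc (gF n R k) (gF n R k), gF_mul_self]
        simp
    · have hx' : x ∈ tailAlg n R (k + 1) := by
        rcases hx with rfl | rfl
        · exact gE_mem_tailAlg h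
        · exact gF_mem_tailAlg h
      exact ⟨x * c, mul_mem hx' hc, x * d, mul_mem hx' hd, by simp only [mul_add, mul_assoc]⟩
  | algebraMap r =>
    rintro _ ⟨c, hc, d, hd, rfl⟩
    exact ⟨algebraMap R _ r * c, mul_mem (Subalgebra.algebraMap_mem _ r) hc,
      algebraMap R _ r * d, mul_mem (Subalgebra.algebraMap_mem _ r) hd,
      by simp only [mul_add, mul_assoc]⟩
  | add x y _ _ hx hy =>
    intro m hm
    obtain ⟨c, hc, d, hd, h⟩ := hx m hm
    obtain ⟨c', hc', d', hd', h'⟩ := hy m hm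
    exact ⟨c + c', add_mem hc hc', d + d', add_mem hd hd', by rw [add_mul, h, h']; noncomm_ring⟩
  | mul x y _ _ hx hy =>
    intro m hm
    rw [mul_assoc]
    exact hx _ (hy m hm)

lemma gF_mul_mul_gF {k : ℕ} (hk : k < n) {b : Cl n R} (hb : b ∈ tailAlg n R k) :
    ∃ d ∈ tailAlg n R (k + 1), gF n R k * b * gF n R k = d * gF n R k := by
  obtain ⟨c, hc, d, hd, h⟩ := mul_gF_of_mem_tailAlg hk hb
  refine ⟨_, involute_mem_tailAlg hd, ?_⟩
  rw [mul_assoc, h, mul_add, ← mul_assoc, ← mul_assoc, gF_mul_of_mem_tailAlg k.lt_succ_self hc,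
    gF_mul_of_mem_tailAlg k.lt_succ_self hd, mul_assoc _ (gF n R k) (gF n R k),
    gF_mul_self, mul_assoc _ (gF n R k) (gE n R k * _), gE_mul_gF_self hk, mul_sub,
    ← mul_assoc (gF n R k) (gF n R k), gF_mul_self]
  simp

lemma tailAlg_zero : tailAlg n R 0 = ⊤ := by
  rw [eq_top_iff, ← CliffordAlgebra.adjoin_range_ι]
  refine Algebra.adjoin_le ?_
  rintro _ ⟨⟨a, b⟩, rfl⟩
  have h : ((a, b) : (Fin n → R) × (Fin n → R)) =
      ∑ i : Fin n, (a i • ((fun j => if j.val = i.val then (1 : R) else 0), (0 : Fin n → R)) +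
        b i • ((0 : Fin n → R), (fun j => if j.val = i.val then (1 : R) else 0))) := by
    ext j <;> simp [Prod.fst_sum, Prod.snd_sum, Finset.sum_apply, ← Fin.ext_iff]
  rw [h, map_sum]
  refine sum_mem fun i _ => ?_
  rw [map_add, map_smul, map_smul]
  exact add_mem (Subalgebra.smul_mem _ (gE_mem_tailAlg (Nat.zero_le _)) _)
    (Subalgebra.smul_mem _ (gF_mem_tailAlg (Nat.zero_le _)) _)

lemma tailAlg_self : tailAlg n R n = ⊥ := by
  rw [eq_bot_iff]
  refine Algebra.adjoin_le ?_
  rintro _ ⟨j, hj, rfl | rfl⟩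
  · have : (fun i : Fin n => if i.val = j then (1 : R) else 0) = 0 := by
      ext i; simp [(i.2.trans_le hj).ne]
    rw [gE, this, ← Prod.zero_eq_mk, map_zero]
    exact zero_mem _
  · have : (fun i : Fin n => if i.val = j then (1 : R) else 0) = 0 := by
      ext i; simp [(i.2.trans_le hj).ne]
    rw [gF, this, ← Prod.zero_eq_mk, map_zero]
    exact zero_mem _

lemma gP_mul_mul_gP_mem {k : ℕ} (hk : k ≤ n) (z : Cl n R) :
    ∃ b ∈ tailAlg n R k, gP n R k * z * gP n R k = b * gP n R k := by
  induction k generalizing z with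
  | zero => exact ⟨z, by rw [tailAlg_zero]; trivial, by simp [gP]⟩
  | succ k ih =>
    obtain ⟨b, hb, h⟩ := ih (by omega) z
    obtain ⟨d, hd, h'⟩ := gF_mul_mul_gF (show k < n by omega) hb
    refine ⟨(-1 : R) ^ k • d, Subalgebra.smul_mem _ hd _, ?_⟩
    calc gP n R k * gF n R k * z * (gP n R k * gF n R k)
        = (-1 : R) ^ k • (gF n R k * (gP n R k * z * gP n R k) * gF n R k) := by
          nth_rewrite 1 [gP_mul_gF]
          simp only [smul_mul_assoc, mul_assoc]
      _ = (-1 : R) ^ k • (gF n R k * b * (gP n R k * gF n R k)) := by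
          rw [h]
          simp only [mul_assoc]
      _ = (-1 : R) ^ k • d * (gP n R k * gF n R k) := by
          rw [gP_mul_gF, mul_smul_comm, ← mul_assoc, h', mul_assoc, smul_mul_assoc, mul_smul_comm]

/-- Compressing by the volume element leaves only scalar multiples of it. -/
lemma gP_mul_mul_gP (z : Cl n R) : ∃ r : R, gP n R n * z * gP n R n = r • gP n R n := by
  obtain ⟨b, hb, h⟩ := gP_mul_mul_gP_mem le_rfl z
  rw [tailAlg_self] at hb
  obtain ⟨r, rfl⟩ := Algebra.mem_bot.mp hb
  exact ⟨r, by rw [h, Algebra.smul_def]⟩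

end Fermion

/-! ### Lifting isometries to the Spin group -/

/-- If `θ` is an automorphism of a ring `A`, `p ∈ A` is an element fixed by `θ` that generates the
unit ideal, and `θ` fixes `pAp` pointwise, then `θ` is conjugation by `∑ θ(xᵢ) p yᵢ`, where
`∑ xᵢ p yᵢ = 1`. If `θ` commutes with an involution which maps `p` to `±p`, this element is
unitary; the same argument shows that it is fixed by a ring endomorphism `α` with these
properties. -/
lemma exists_unitary_of_fixes_corner {A : Type*} [Ring A] [StarRing A] (θ θ' α : A →+* A)
    (hθ : ∀ z, θ (θ' z) = z) {p : A} (hp : θ p = p) (hpp : ∀ z, θ (p * z * p) = p * z * p)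
    {s : Type*} [Fintype s] (x y : s → A) (hxy : ∑ i, x i * p * y i = 1)
    (hstar : ∀ z, θ (star z) = star (θ z)) (hpstar : star p = p ∨ star p = -p)
    (hα : ∀ z, θ (α z) = α (θ z)) (hpα : α p = p ∨ α p = -p) :
    ∃ T : A, T * star T = 1 ∧ star T * T = 1 ∧ α T = T ∧ ∀ z, T * z = θ z * T := by
  set T : A := ∑ i, θ (x i) * p * y i with hT
  have key : ∀ u w, T * (u * p * w) = θ u * p * w := fun u w => by
    have h1 : ∀ i, θ (x i) * p * y i * (u * p * w) = θ (x i * p * y i * (u * p)) * w := by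
      intro i
      have : x i * p * y i * (u * p) = x i * (p * (y i * u) * p) := by noncomm_ring
      rw [this, map_mul, hpp]
      noncomm_ring
    rw [hT, Finset.sum_mul, Finset.sum_congr rfl fun i _ => h1 i, ← Finset.sum_mul, ← map_sum,
      ← Finset.sum_mul, hxy, one_mul, map_mul, hp]
  have hsum : ∀ z, z = ∑ i, z * x i * p * y i := fun z => by
    conv_lhs => rw [← mul_one z, ← hxy, Finset.mul_sum]
    simp only [mul_assoc]
  have hTz : ∀ z, T * z = θ z * T := fun z => by
    conv_lhs => rw [hsum z, Finset.mul_sum, Finset.sum_congr rfl fun i _ => key _ _]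
    rw [hT, Finset.mul_sum]
    simp only [map_mul, mul_assoc]
  have hTp : T * p = p := by simpa using key 1 1
  have hpT : p * T = p := by
    have := hTz p
    rw [hp, hTp] at this
    exact this.symm
  have hsTp : star T * p = p := by
    have := congrArg star hpT
    rw [star_mul] at this
    rcases hpstar with h | h <;> simpa [h] using this
  have hsT : ∀ z, star T * θ z = z * star T := fun z => by
    have := congrArg star (hTz (star z))
    rwa [star_mul, star_mul, star_star, hstar, star_star, eq_comm] at this
  have h1 : star T * T = 1 := by
    rw [hsum (star T * T), ← hxy]
    refine Finset.sum_congr rfl fun i _ => ?_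
    rw [mul_assoc (star T), hTz, ← mul_assoc (star T), hsT, mul_assoc (x i), mul_assoc (x i),
      mul_assoc (star T), hTp, hsTp]
  have h2 : T * ∑ i, θ' (x i) * p * y i = 1 := by
    rw [Finset.mul_sum, Finset.sum_congr rfl fun i _ => key _ _]
    simpa [hθ] using hxy
  have h3 : star T = ∑ i, θ' (x i) * p * y i := left_inv_eq_right_inv h1 h2
  refine ⟨T, h3 ▸ h2, h1, ?_, hTz⟩
  have h4 : T * (∑ i, α (x i) * p * α (y i)) = ∑ i, α (θ (x i)) * p * α (y i) := by
    rw [Finset.mul_sum, Finset.sum_congr rfl fun i _ => key _ _]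
    simp only [hα]
  have h5 := congrArg α hxy
  have h6 := congrArg α hT
  simp only [map_sum, map_mul, map_one] at h5 h6
  rcases hpα with h | h
  · rw [h] at h5 h6
    rw [h6, ← h4, h5, mul_one]
  · simp only [h, mul_neg, neg_mul, Finset.sum_neg_distrib] at h5 h6
    rw [h6, ← h4, ← mul_neg, h5, mul_one]

section Lift

variable {R : Type*} [CommRing R] {n : ℕ}

/-- The isometry `(a, b) ↦ (g a, h b)` of the hyperbolic space, where `hᵀ g = 1`. -/
def dualIsometry (g h : Matrix (Fin n) (Fin n) R) (hgh : hᵀ * g = 1) :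
    quadForm n R →qᵢ quadForm n R where
  toLinearMap := (mulVecLin g).prodMap (mulVecLin h)
  map_app' v := by
    have : (g *ᵥ v.1) ⬝ᵥ (h *ᵥ v.2) = v.1 ⬝ᵥ v.2 := by
      rw [dotProduct_mulVec, ← mulVec_transpose, mulVec_mulVec, hgh, one_mulVec]
    simpa [quadForm_apply, dotProduct] using this

lemma dualIsometry_apply (g h : Matrix (Fin n) (Fin n) R) (hgh : hᵀ * g = 1)
    (v : (Fin n → R) × (Fin n → R)) : dualIsometry g h hgh v = (g *ᵥ v.1, h *ᵥ v.2) := rfl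

lemma star_map (f : quadForm n R →qᵢ quadForm n R) (z : Cl n R) :
    CliffordAlgebra.map f (star z) = star (CliffordAlgebra.map f z) := by
  induction z using CliffordAlgebra.induction with
  | algebraMap r => simp
  | ι v => simp
  | mul x y hx hy => simp [hx, hy]
  | add x y hx hy => simp [hx, hy]

lemma involute_map (f : quadForm n R →qᵢ quadForm n R) (z : Cl n R) :
    CliffordAlgebra.map f (CliffordAlgebra.involute z) =
      CliffordAlgebra.involute (CliffordAlgebra.map f z) := by
  induction z using CliffordAlgebra.induction with
  | algebraMap r => simp
  | ι v => simp
  | mul x y hx hy => simp [hx, hy]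
  | add x y hx hy => simp [hx, hy]

/-- The exterior algebra of the second summand maps to the Clifford algebra. -/
def extMap (n : ℕ) (R : Type*) [CommRing R] : ExteriorAlgebra R (Fin n → R) →ₐ[R] Cl n R :=
  ExteriorAlgebra.lift R ⟨CliffordAlgebra.ι (quadForm n R) ∘ₗ LinearMap.inr R _ _, fun v => by
    simp [CliffordAlgebra.ι_sq_scalar, quadForm_apply]⟩

/-- The alternating map `(v_1, …, v_n) ↦ (0, v_1) ⋯ (0, v_n)`. -/
def volMap (n : ℕ) (R : Type*) [CommRing R] : (Fin n → R) [⋀^Fin n]→ₗ[R] Cl n R :=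
  (extMap n R).toLinearMap.compAlternatingMap (ExteriorAlgebra.ιMulti R n)

lemma volMap_apply (v : Fin n → Fin n → R) :
    volMap n R v = (List.ofFn fun i => CliffordAlgebra.ι (quadForm n R) (0, v i)).prod := by
  simp [volMap, ExteriorAlgebra.ιMulti_apply, extMap, map_list_prod, List.map_ofFn,
    Function.comp_def]

lemma volMap_eq_det (v : Fin n → Fin n → R) :
    volMap n R v = (Matrix.of v).det • volMap n R (fun i => Pi.single i 1) := by
  have : volMap n R = (LinearMap.toSpanSingleton R _
      (volMap n R (fun i => Pi.single i 1))).compAlternatingMap (Pi.basisFun R (Fin n)).det := by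
    refine Module.Basis.ext_alternating (Pi.basisFun R (Fin n)) fun σ hσ => ?_
    obtain ⟨τ, rfl⟩ : ∃ τ : Equiv.Perm (Fin n), ⇑τ = σ :=
      ⟨Equiv.ofBijective σ (Finite.injective_iff_bijective.mp hσ), rfl⟩
    have h1 := (volMap n R).map_perm (fun i => Pi.basisFun R (Fin n) i) τ
    have h2 := (Pi.basisFun R (Fin n)).det.map_perm (fun i => Pi.basisFun R (Fin n) i) τ
    have h3 : (Pi.basisFun R (Fin n)).det (fun i => Pi.basisFun R (Fin n) i) = 1 :=
      (Pi.basisFun R (Fin n)).det_self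
    simp only [Function.comp_def] at h1 h2
    rw [h1, LinearMap.compAlternatingMap_apply, h2, h3]
    rcases Int.units_eq_one_or (Equiv.Perm.sign τ) with h | h <;> simp [h]
  conv_lhs => rw [this]
  simp
  rfl

lemma gP_eq_prod_ofFn (k : ℕ) : gP n R k = (List.ofFn fun i : Fin k => gF n R i).prod := by
  induction k with
  | zero => simp [gP]
  | succ k ih => rw [List.ofFn_succ', List.prod_concat, gP, ih]; rfl

lemma gP_eq_volMap : gP n R n = volMap n R (fun i => Pi.single i 1) := by
  rw [gP_eq_prod_ofFn, volMap_apply]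
  congr 2
  ext1 i
  rw [gF]
  congr 2
  ext j
  simp [Pi.single_apply, Fin.ext_iff]

lemma map_dualIsometry_gP (g h : Matrix (Fin n) (Fin n) R) (hgh : hᵀ * g = 1) :
    CliffordAlgebra.map (dualIsometry g h hgh) (gP n R n) = h.det • gP n R n := by
  have : CliffordAlgebra.map (dualIsometry g h hgh) (gP n R n) =
      volMap n R (fun i => hᵀ i) := by
    rw [gP_eq_volMap, volMap_apply, volMap_apply, map_list_prod, List.map_ofFn]
    congr 2
    ext1 i
    simp [dualIsometry_apply]
    rfl
  rw [this, volMap_eq_det, ← gP_eq_volMap, ← det_transpose h]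
  rfl

lemma mem_evenOdd_zero_of_involute_eq [Invertible (2 : R)] {z : Cl n R}
    (h : CliffordAlgebra.involute z = z) : z ∈ CliffordAlgebra.evenOdd (quadForm n R) 0 := by
  obtain ⟨a, ha, b, hb, rfl⟩ := Submodule.mem_sup.mp
    ((CliffordAlgebra.evenOdd_isCompl (quadForm n R)).sup_eq_top.ge (Submodule.mem_top (x := z)))
  rw [map_add, CliffordAlgebra.involute_eq_of_mem_even ha,
    CliffordAlgebra.involute_eq_of_mem_odd hb, add_right_inj, neg_eq_iff_add_eq_zero] at h
  have : b = 0 := by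
    rw [← one_smul R b, ← invOf_mul_self (2 : R), mul_smul, two_smul, h, smul_zero]
  rw [this, add_zero]
  exact ha

/-- A criterion for membership in the Spin group: it suffices that conjugation by `g` and by its
inverse `g*` maps vectors to vectors. -/
lemma mem_spin_of_conj {g : (Cl n R)ˣ}
    (h0 : g.val ∈ CliffordAlgebra.evenOdd (quadForm n R) 0) (h1 : g.val * star g.val = 1)
    (h2 : ∀ v, ∃ w, g.val * CliffordAlgebra.ι (quadForm n R) v * star g.val =
      CliffordAlgebra.ι (quadForm n R) w)
    (h3 : ∀ v, ∃ w, star g.val * CliffordAlgebra.ι (quadForm n R) v * g.val =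
      CliffordAlgebra.ι (quadForm n R) w) : g ∈ spin n R := by
  have hs : g⁻¹.val = star g.val := by
    rw [← one_mul (star g.val), ← g.inv_mul, mul_assoc, h1, mul_one]
  have h1' : star g.val * g.val = 1 := by rw [← hs, g.inv_mul]
  refine ⟨h0, h1, Set.Subset.antisymm ?_ ?_⟩
  · rintro _ ⟨_, ⟨v, rfl⟩, rfl⟩
    obtain ⟨w, hw⟩ := h2 v
    exact ⟨w, by rw [← hw, ← hs]⟩
  · rintro _ ⟨v, rfl⟩
    obtain ⟨w, hw⟩ := h3 v
    refine ⟨_, ⟨w, rfl⟩, ?_⟩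
    simp only [← hw, hs, ← mul_assoc, h1, one_mul]
    rw [mul_assoc, h1, mul_one]

/-- Every isometry `(a, b) ↦ (g a, h b)` with `hᵀ g = 1` and `det h = 1` is conjugation by an
element of the Spin group. -/
lemma exists_spin_of_det_eq_one [Invertible (2 : R)] (g h : Matrix (Fin n) (Fin n) R)
    (hgh : hᵀ * g = 1) (hdet : h.det = 1) :
    ∃ T ∈ spin n R, ∀ v, T.val * CliffordAlgebra.ι (quadForm n R) v * T⁻¹.val =
      CliffordAlgebra.ι (quadForm n R) (g *ᵥ v.1, h *ᵥ v.2) := by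
  have hgh' : g * hᵀ = 1 := mul_eq_one_comm.mp hgh
  have hhg' : (gᵀ)ᵀ * hᵀ = 1 := by rw [transpose_transpose, hgh']
  have hhg : h * gᵀ = 1 := by rw [← transpose_transpose h, ← transpose_mul, hgh', transpose_one]
  set θ := CliffordAlgebra.map (dualIsometry g h hgh)
  set θ' := CliffordAlgebra.map (dualIsometry hᵀ gᵀ hhg')
  have hθ : ∀ z, θ (θ' z) = z := by
    intro z
    have : θ.comp θ' = AlgHom.id R _ := by
      refine CliffordAlgebra.hom_ext (LinearMap.ext fun v => ?_)
      simp [θ, θ', dualIsometry_apply, mulVec_mulVec, hgh', hhg]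
    exact DFunLike.congr_fun this z
  have hp : θ (gP n R n) = gP n R n := by
    rw [map_dualIsometry_gP, hdet, one_smul]
  obtain ⟨s, _, x, y, hxy⟩ := exists_sum_mul_gP_mul (R := R) (le_refl n)
  obtain ⟨T, h1, h2, h3, h4⟩ := exists_unitary_of_fixes_corner θ.toRingHom θ'.toRingHom
    (CliffordAlgebra.involute (Q := quadForm n R)).toRingHom hθ hp
    (fun z => by
      obtain ⟨r, hr⟩ := gP_mul_mul_gP z
      change θ _ = _
      rw [hr, map_smul, hp]) x y hxy (star_map _) (star_gP n) (involute_map _) (involute_gP n)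
  have hT : ∀ v, T * CliffordAlgebra.ι (quadForm n R) v * star T =
      CliffordAlgebra.ι (quadForm n R) (g *ᵥ v.1, h *ᵥ v.2) := fun v => by
    rw [h4, mul_assoc, h1, mul_one]
    simp [θ, dualIsometry_apply]
  refine ⟨⟨T, star T, h1, h2⟩, mem_spin_of_conj (mem_evenOdd_zero_of_involute_eq h3) h1
    (fun v => ⟨_, hT v⟩) (fun v => ⟨(hᵀ *ᵥ v.1, gᵀ *ᵥ v.2), ?_⟩), hT⟩
  have := hT (hᵀ *ᵥ v.1, gᵀ *ᵥ v.2)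
  simp only [mulVec_mulVec, hgh', hhg, one_mulVec, Prod.mk.eta] at this
  change star T * _ * T = _
  rw [← this]
  simp only [← mul_assoc, h2, one_mul]
  rw [mul_assoc, h2, mul_one]

/-- Two unit vectors with the same first component lie in the same orbit: if `a ⬝ b = 1` and
`a ⬝ w = 0`, the Spin element `1 + f_w f_b` maps `(a, b)` to `(a, b + w)`. -/
lemma exists_spin_of_fst_eq (a b c : Fin n → R) (hb : a ⬝ᵥ b = 1) (hc : a ⬝ᵥ c = 1) :
    ∃ T ∈ spin n R, T.val * CliffordAlgebra.ι (quadForm n R) (a, b) * T⁻¹.val =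
      CliffordAlgebra.ι (quadForm n R) (a, c) := by
  set F : Cl n R := CliffordAlgebra.ι (quadForm n R) (0, c - b) with hF
  set G : Cl n R := CliffordAlgebra.ι (quadForm n R) (0, b) with hG
  have hFF : F * F = 0 := by simp [hF, CliffordAlgebra.ι_sq_scalar, quadForm_apply]
  have hGG : G * G = 0 := by simp [hG, CliffordAlgebra.ι_sq_scalar, quadForm_apply]
  have hGF : G * F = -(F * G) := by
    rw [hF, hG, CliffordAlgebra.ι_mul_ι_comm, polar_quadForm]
    simp
  have huu : F * G * (F * G) = 0 := by
    rw [mul_assoc, ← mul_assoc G, hGF, neg_mul, mul_assoc, hGG]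
    simp
  have hst : star (1 + F * G) = 1 - F * G := by
    rw [star_add, star_one, star_mul, hF, hG, CliffordAlgebra.star_ι, CliffordAlgebra.star_ι,
      ← hF, ← hG, neg_mul_neg, hGF, sub_eq_add_neg]
  have h1 : (1 + F * G) * (1 - F * G) = 1 := by
    rw [add_mul, mul_sub, mul_sub, huu]; simp
  have h2 : (1 - F * G) * (1 + F * G) = 1 := by
    rw [sub_mul, mul_add, mul_add, huu]; simp
  have hFv : ∀ v, CliffordAlgebra.ι (quadForm n R) v * F =
      algebraMap R _ (v.1 ⬝ᵥ (c - b)) - F * CliffordAlgebra.ι (quadForm n R) v := fun v => by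
    rw [hF, CliffordAlgebra.ι_mul_ι_comm, polar_quadForm]
    simp
  have hGv : ∀ v, CliffordAlgebra.ι (quadForm n R) v * G =
      algebraMap R _ (v.1 ⬝ᵥ b) - G * CliffordAlgebra.ι (quadForm n R) v := fun v => by
    rw [hG, CliffordAlgebra.ι_mul_ι_comm, polar_quadForm]
    simp
  -- the commutator `[F G, v]`
  set W : (Fin n → R) × (Fin n → R) → (Fin n → R) × (Fin n → R) := fun v =>
    (0, (v.1 ⬝ᵥ b) • (c - b) - (v.1 ⬝ᵥ (c - b)) • b) with hW
  have hιW : ∀ v, CliffordAlgebra.ι (quadForm n R) (W v) =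
      (v.1 ⬝ᵥ b) • F - (v.1 ⬝ᵥ (c - b)) • G := fun v => by
    rw [hF, hG, ← map_smul, ← map_smul, ← map_sub]
    simp [hW]
  have hcomm : ∀ v, CliffordAlgebra.ι (quadForm n R) v * (F * G) =
      F * G * CliffordAlgebra.ι (quadForm n R) v - CliffordAlgebra.ι (quadForm n R) (W v) :=
    fun v => by
      rw [hιW, ← mul_assoc, hFv, sub_mul, mul_assoc, hGv, mul_sub, Algebra.smul_def,
        Algebra.smul_def, ← Algebra.commutes (v.1 ⬝ᵥ b), mul_assoc]
      abel
  have hFGW : ∀ v, F * G * CliffordAlgebra.ι (quadForm n R) (W v) = 0 := fun v => by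
    have h : F * G * F = 0 := by
      rw [mul_assoc, hGF, mul_neg, ← mul_assoc, hFF]; simp
    rw [hιW, mul_sub, mul_smul_comm, mul_smul_comm, h, mul_assoc, hGG]
    simp
  have hFGv : ∀ v, F * G * (CliffordAlgebra.ι (quadForm n R) v * (F * G)) = 0 := fun v => by
    rw [hcomm, mul_sub, hFGW, ← mul_assoc, huu]
    simp
  have hconj : ∀ v, (1 + F * G) * CliffordAlgebra.ι (quadForm n R) v * (1 - F * G) =
      CliffordAlgebra.ι (quadForm n R) (v + W v) := fun v => by
    rw [mul_assoc, mul_sub, mul_one, add_mul, one_mul, mul_sub, hFGv, hcomm, map_add]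
    abel
  have hconj' : ∀ v, (1 - F * G) * CliffordAlgebra.ι (quadForm n R) v * (1 + F * G) =
      CliffordAlgebra.ι (quadForm n R) (v - W v) := fun v => by
    rw [mul_assoc, mul_add, mul_one, sub_mul, one_mul, mul_add, hFGv, hcomm, map_sub]
    abel
  have heven : 1 + F * G ∈ CliffordAlgebra.evenOdd (quadForm n R) 0 :=
    add_mem (SetLike.one_mem_graded _) (CliffordAlgebra.ι_mul_ι_mem_evenOdd_zero _ _ _)
  refine ⟨⟨1 + F * G, 1 - F * G, h1, h2⟩, mem_spin_of_conj heven ?_ (fun v => ⟨v + W v, ?_⟩)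
    (fun v => ⟨v - W v, ?_⟩), ?_⟩
  · change (1 + F * G) * star (1 + F * G) = 1
    rw [hst, h1]
  · change (1 + F * G) * _ * star (1 + F * G) = _
    rw [hst, hconj]
  · change star (1 + F * G) * _ * (1 + F * G) = _
    rw [hst, hconj']
  · refine (hconj (a, b)).trans ?_
    simp [hW, hb, hc, dotProduct_sub]

end Lift

/-! ### Suslin matrices and the Clifford algebra -/

section Suslin

variable {R : Type*} [CommRing R] {n : ℕ}

section Blocks

variable (A B C D A' B' C' D' : Matrix (Fin (2 ^ n)) (Fin (2 ^ n)) R)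

lemma blk_mul : blk A B C D * blk A' B' C' D' =
    blk (A * A' + B * C') (A * B' + B * D') (C * A' + D * C') (C * B' + D * D') := by
  simp only [blk, reindex_apply]
  rw [submatrix_mul_equiv, fromBlocks_multiply]

lemma blk_transpose {S : Type*} (A B C D : Matrix (Fin (2 ^ n)) (Fin (2 ^ n)) S) :
    (blk A B C D)ᵀ = blk Aᵀ Cᵀ Bᵀ Dᵀ := by
  simp only [blk, reindex_apply]
  rw [transpose_submatrix, fromBlocks_transpose]

lemma blk_add : blk A B C D + blk A' B' C' D' =
    blk (A + A') (B + B') (C + C') (D + D') := by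
  simp only [blk, reindex_apply, ← fromBlocks_add]
  rfl

lemma blk_smul (r : R) : r • blk A B C D = blk (r • A) (r • B) (r • C) (r • D) := by
  simp only [blk, reindex_apply, ← fromBlocks_smul]
  rfl

lemma blk_neg : -blk A B C D = blk (-A) (-B) (-C) (-D) := by
  simp only [blk, reindex_apply, ← fromBlocks_neg]
  rfl

lemma blk_one : blk (1 : Matrix (Fin (2 ^ n)) (Fin (2 ^ n)) R) 0 0 1 = 1 := by
  simp only [blk, reindex_apply, fromBlocks_one]
  rw [submatrix_one_equiv]

lemma isUnit_blk_diag {A D : Matrix (Fin (2 ^ n)) (Fin (2 ^ n)) R} (hA : IsUnit A)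
    (hD : IsUnit D) : IsUnit (blk A 0 0 D) := by
  obtain ⟨a, rfl⟩ := hA
  obtain ⟨d, rfl⟩ := hD
  refine IsUnit.of_mul_eq_one (blk a⁻¹.val 0 0 d⁻¹.val) ?_
  simp [blk_mul, blk_one]

lemma isUnit_blk_upper : IsUnit (blk 1 B 0 1) := by
  refine IsUnit.of_mul_eq_one (blk 1 (-B) 0 1) ?_
  simp [blk_mul, blk_one]

lemma isUnit_blk_lower : IsUnit (blk 1 0 C 1) := by
  refine IsUnit.of_mul_eq_one (blk 1 0 (-C) 1) ?_
  simp [blk_mul, blk_one]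

end Blocks

/-- The Suslin matrix of vectors of length `n + 1`, with index set in the normal form
`Fin (2 ^ n)`. -/
def sus (n : ℕ) (a b : Fin (n + 1) → R) : Matrix (Fin (2 ^ n)) (Fin (2 ^ n)) R :=
  suslin (n + 1) a b

/-- The matrix `J_{n+1}`, with index set in the normal form `Fin (2 ^ n)`. -/
def jmat (R : Type*) [CommRing R] (n : ℕ) : Matrix (Fin (2 ^ n)) (Fin (2 ^ n)) R :=
  matJ R (n + 1)

lemma sus_zero (a b : Fin 1 → R) : sus 0 a b = a 0 • 1 := by
  ext i j
  have : i = j := Subsingleton.elim (α := Fin 1) i j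
  subst this
  refine (mul_one (a 0)).symm.trans ?_
  rw [Matrix.smul_apply, one_apply_eq, smul_eq_mul]

lemma sus_succ (a b : Fin (n + 2) → R) : sus (n + 1) a b =
    blk (a 0 • 1) (sus n (Fin.tail a) (Fin.tail b))
      (-(sus n (Fin.tail b) (Fin.tail a))ᵀ) (b 0 • 1) := rfl

lemma jmat_zero : jmat R 0 = 1 := rfl

lemma jmat_succ_of_even (h : Even n) :
    jmat R (n + 1) = blk 0 (jmat R n) (-jmat R n) 0 :=
  if_pos (by obtain ⟨k, rfl⟩ := h; omega)

lemma jmat_succ_of_odd (h : Odd n) :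
    jmat R (n + 1) = blk (jmat R n) 0 0 (-jmat R n) :=
  if_neg (by obtain ⟨k, rfl⟩ := h; omega)

lemma sus_add (a b a' b' : Fin (n + 1) → R) :
    sus n (a + a') (b + b') = sus n a b + sus n a' b' := by
  induction n with
  | zero => simp [sus_zero, add_smul]
  | succ n ih =>
    have ht : ∀ u v : Fin (n + 2) → R, Fin.tail (u + v) = Fin.tail u + Fin.tail v :=
      fun _ _ => rfl
    simp only [sus_succ, blk_add, ht, ih, transpose_add, neg_add, Pi.add_apply, add_smul]

lemma sus_smul (r : R) (a b : Fin (n + 1) → R) : sus n (r • a) (r • b) = r • sus n a b := by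
  induction n with
  | zero => simp [sus_zero, smul_smul]
  | succ n ih =>
    have ht : ∀ u : Fin (n + 2) → R, Fin.tail (r • u) = r • Fin.tail u := fun _ => rfl
    simp only [sus_succ, blk_smul, ht, ih, transpose_smul, smul_neg, Pi.smul_apply, smul_smul,
      smul_eq_mul]

/-- The defining property `S(a, b) S(b, a)ᵀ = (a ⬝ b) 1` of the Suslin matrices. -/
lemma sus_mul_transpose (a b : Fin (n + 1) → R) :
    sus n a b * (sus n b a)ᵀ = (a ⬝ᵥ b) • 1 ∧ (sus n b a)ᵀ * sus n a b = (a ⬝ᵥ b) • 1 := by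
  induction n with
  | zero => simp [sus_zero, smul_smul, dotProduct, mul_comm]
  | succ n ih =>
    have hd : a ⬝ᵥ b = a 0 * b 0 + Fin.tail a ⬝ᵥ Fin.tail b := by
      simp [dotProduct, Fin.sum_univ_succ, Fin.tail]
    obtain ⟨h1, h2⟩ := ih (Fin.tail a) (Fin.tail b)
    rw [hd, ← blk_one, blk_smul]
    simp only [sus_succ, blk_transpose, blk_mul, transpose_neg, transpose_transpose,
      transpose_smul, transpose_one]
    constructor <;> congr 1 <;>
      simp [h1, h2, add_smul, smul_smul, mul_comm, add_comm]

lemma jmat_transpose : (jmat R n)ᵀ = jmat R n ∧ (n % 4 = 0 ∨ n % 4 = 3) ∨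
    (jmat R n)ᵀ = -jmat R n ∧ (n % 4 = 1 ∨ n % 4 = 2) := by
  induction n with
  | zero => left; simp [jmat_zero]
  | succ n ih =>
    rcases Nat.even_or_odd n with h | h
    · rw [jmat_succ_of_even h, blk_transpose]
      obtain ⟨k, rfl⟩ := h
      rcases ih with ⟨ih, hk⟩ | ⟨ih, hk⟩
      · right
        exact ⟨by simp [ih, blk_neg], by omega⟩
      · left
        exact ⟨by simp [ih], by omega⟩
    · rw [jmat_succ_of_odd h, blk_transpose]
      obtain ⟨k, rfl⟩ := h
      rcases ih with ⟨ih, hk⟩ | ⟨ih, hk⟩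
      · left
        exact ⟨by simp [ih], by omega⟩
      · right
        exact ⟨by simp [ih, blk_neg], by omega⟩

lemma jmat_mul_transpose : jmat R n * (jmat R n)ᵀ = 1 := by
  induction n with
  | zero => simp [jmat_zero]
  | succ n ih =>
    rcases Nat.even_or_odd n with h | h
    · simp [jmat_succ_of_even h, blk_transpose, blk_mul, ih, blk_one]
    · simp [jmat_succ_of_odd h, blk_transpose, blk_mul, ih, blk_one]

lemma isUnit_jmat : IsUnit (jmat R n) := IsUnit.of_mul_eq_one _ jmat_mul_transpose

/-- This comes from transposing the identity `S J = J S'`, since `Jᵀ = ± J`. -/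
lemma jmat_mul_transpose_of_comm {S S' : Matrix (Fin (2 ^ n)) (Fin (2 ^ n)) R}
    (h : S * jmat R n = jmat R n * S') : jmat R n * Sᵀ = S'ᵀ * jmat R n := by
  have := congrArg transpose h
  rw [transpose_mul, transpose_mul] at this
  rcases jmat_transpose (R := R) (n := n) with ⟨h', -⟩ | ⟨h', -⟩ <;> simpa [h'] using this

/-- This holds because `J⁻¹ = Jᵀ = ± J`. -/
lemma jmat_comm_swap {S S' : Matrix (Fin (2 ^ n)) (Fin (2 ^ n)) R}
    (h : S * jmat R n = jmat R n * S') : S' * jmat R n = jmat R n * S := by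
  have h1 : (jmat R n)ᵀ * jmat R n = 1 := mul_eq_one_comm.mp jmat_mul_transpose
  have h2 : S' * (jmat R n)ᵀ = (jmat R n)ᵀ * S := by
    calc S' * (jmat R n)ᵀ = (jmat R n)ᵀ * jmat R n * S' * (jmat R n)ᵀ := by rw [h1, one_mul]
      _ = (jmat R n)ᵀ * S := by
        rw [mul_assoc (jmat R n)ᵀ, ← h, mul_assoc, mul_assoc, jmat_mul_transpose, mul_one]
  rcases jmat_transpose (R := R) (n := n) with ⟨h', -⟩ | ⟨h', -⟩ <;> simpa [h'] using h2

/-- Suslin matrices of vectors of odd length commute with `J` up to transposition, and those of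
vectors of even length up to exchanging the two vectors. -/
lemma sus_mul_jmat (a b : Fin (n + 1) → R) :
    (Even n → sus n a b * jmat R n = jmat R n * (sus n a b)ᵀ) ∧
      (Odd n → sus n a b * jmat R n = jmat R n * sus n b a) := by
  induction n with
  | zero => exact ⟨fun _ => by simp [sus_zero, jmat_zero], fun h => by simp at h⟩
  | succ n ih =>
    have hi := ih (Fin.tail a) (Fin.tail b)
    have hi' := ih (Fin.tail b) (Fin.tail a)
    constructor
    · intro h
      have h' : Odd n := by simpa [parity_simps] using h
      have e1 := hi.2 h'
      have e2 := jmat_mul_transpose_of_comm e1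
      rw [sus_succ, jmat_succ_of_odd h', blk_transpose, blk_mul, blk_mul]
      simp [e1, e2]
    · intro h
      have h' : Even n := by simpa [parity_simps] using h
      have e1 := hi.1 h'
      have e2 := jmat_comm_swap (hi'.1 h')
      rw [sus_succ, sus_succ, jmat_succ_of_even h', blk_mul, blk_mul]
      simp [e1, e2]

/-- The representation of the Clifford algebra on `R^N ⊕ R^N`, `N = 2^n`, in which a vector `(a, b)`
acts as `(0 S(a, b); S(b, a)ᵀ 0)`. -/
def suslinRep (n : ℕ) (R : Type*) [CommRing R] :
    Cl (n + 1) R →ₐ[R] Matrix (Fin (2 ^ n) ⊕ Fin (2 ^ n)) (Fin (2 ^ n) ⊕ Fin (2 ^ n)) R :=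
  CliffordAlgebra.lift (quadForm (n + 1) R)
    ⟨{ toFun := fun v => fromBlocks 0 (sus n v.1 v.2) (sus n v.2 v.1)ᵀ 0
       map_add' := fun v w => by simp [sus_add, fromBlocks_add]
       map_smul' := fun r v => by simp [sus_smul, fromBlocks_smul] }, fun v => by
      have hq : quadForm (n + 1) R v = v.1 ⬝ᵥ v.2 := quadForm_apply _ _
      obtain ⟨h1, h2⟩ := sus_mul_transpose v.1 v.2
      rw [hq, Algebra.algebraMap_eq_smul_one, ← fromBlocks_one, fromBlocks_smul]
      simp [fromBlocks_multiply, h1, h2]⟩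

lemma suslinRep_ι (v : (Fin (n + 1) → R) × (Fin (n + 1) → R)) :
    suslinRep n R (CliffordAlgebra.ι _ v) =
      fromBlocks 0 (sus n v.1 v.2) (sus n v.2 v.1)ᵀ 0 := by
  simp [suslinRep]

/-- Even elements of the Clifford algebra act by block diagonal matrices. -/
lemma suslinRep_even {z : Cl (n + 1) R}
    (hz : z ∈ CliffordAlgebra.evenOdd (quadForm (n + 1) R) 0) :
    ∃ g₁ g₂, suslinRep n R z = fromBlocks g₁ 0 0 g₂ := by
  induction z, hz using CliffordAlgebra.even_induction with
  | algebraMap r =>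
    exact ⟨r • 1, r • 1, by
      rw [AlgHom.commutes, Algebra.algebraMap_eq_smul_one, ← fromBlocks_one, fromBlocks_smul]
      simp⟩
  | add x y _ _ hx hy =>
    obtain ⟨a, b, h⟩ := hx
    obtain ⟨c, d, h'⟩ := hy
    exact ⟨a + c, b + d, by simp [h, h', fromBlocks_add]⟩
  | ι_mul_ι_mul v w x _ hx =>
    obtain ⟨a, b, h⟩ := hx
    refine ⟨sus n v.1 v.2 * (sus n w.2 w.1)ᵀ * a, (sus n v.2 v.1)ᵀ * sus n w.1 w.2 * b, ?_⟩
    simp [suslinRep_ι, h, fromBlocks_multiply]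

/-- For vectors of odd length, the standard involution of the Clifford algebra corresponds to the
involution adjoint to the form `(0 J; -J 0)`. -/
lemma suslinRep_star (hn : Even n) (z : Cl (n + 1) R) :
    suslinRep n R (star z) * fromBlocks 0 (jmat R n) (-jmat R n) 0 =
      fromBlocks 0 (jmat R n) (-jmat R n) 0 * (suslinRep n R z)ᵀ := by
  induction z using CliffordAlgebra.induction with
  | algebraMap r =>
    rw [CliffordAlgebra.star_algebraMap, AlgHom.commutes, Algebra.algebraMap_eq_smul_one]
    simp
  | ι v =>
    have h1 := (sus_mul_jmat v.1 v.2).1 hn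
    have h2 := jmat_comm_swap ((sus_mul_jmat v.2 v.1).1 hn)
    rw [CliffordAlgebra.star_ι, map_neg, suslinRep_ι, fromBlocks_neg, fromBlocks_transpose,
      fromBlocks_multiply, fromBlocks_multiply]
    simp [h1, h2]
  | mul x y hx hy =>
    rw [star_mul, map_mul, map_mul, transpose_mul, mul_assoc, hx, ← mul_assoc, hy, mul_assoc]
  | add x y hx hy => rw [star_add, map_add, map_add, transpose_add, add_mul, mul_add, hx, hy]

/-- Vectors in the same orbit of the Spin group have congruent matrices `S J`; the congruence is
given by the upper left block of the Spin element. -/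
lemma exists_sus_congr (hn : Even n) {x y : (Fin (n + 1) → R) × (Fin (n + 1) → R)}
    {g : (Cl (n + 1) R)ˣ} (hg : g ∈ spin (n + 1) R)
    (h : g.val * CliffordAlgebra.ι (quadForm (n + 1) R) x * g⁻¹.val =
      CliffordAlgebra.ι (quadForm (n + 1) R) y) :
    ∃ G : Matrix (Fin (2 ^ n)) (Fin (2 ^ n)) R, IsUnit G ∧
      sus n y.1 y.2 * jmat R n = G * (sus n x.1 x.2 * jmat R n) * Gᵀ := by
  obtain ⟨h0, h1, -⟩ := hg
  obtain ⟨g₁, g₂, hg⟩ := suslinRep_even h0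
  have e1 : suslinRep n R g.val * (fromBlocks 0 (jmat R n) (-jmat R n) 0 *
      (suslinRep n R g.val)ᵀ) = fromBlocks 0 (jmat R n) (-jmat R n) 0 := by
    rw [← suslinRep_star hn, ← mul_assoc, ← map_mul, h1, map_one, one_mul]
  have e2 : suslinRep n R g.val * suslinRep n R (CliffordAlgebra.ι _ x) =
      suslinRep n R (CliffordAlgebra.ι _ y) * suslinRep n R g.val := by
    rw [← map_mul, ← map_mul, ← h, mul_assoc _ g⁻¹.val, g.inv_mul, mul_one]
  rw [hg, fromBlocks_transpose, fromBlocks_multiply, fromBlocks_multiply] at e1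
  rw [hg, suslinRep_ι, suslinRep_ι, fromBlocks_multiply, fromBlocks_multiply] at e2
  have e3 := (fromBlocks_inj.mp e1)
  have e4 := (fromBlocks_inj.mp e2).2.1
  simp only [transpose_zero, mul_zero, zero_mul, add_zero, zero_add, neg_mul, mul_neg,
    neg_inj] at e3 e4
  obtain ⟨-, e5, e6, -⟩ := e3
  refine ⟨g₁, ?_, ?_⟩
  · refine IsUnit.of_mul_eq_one (jmat R n * g₂ᵀ * (jmat R n)ᵀ) ?_
    rw [← mul_assoc, e5, jmat_mul_transpose]
  · rw [← mul_assoc, e4, mul_assoc _ g₂, mul_assoc _ (g₂ * _), mul_assoc g₂, e6]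

lemma isUnit_diagPow {m : ℕ} {B : Matrix (Fin 2) (Fin 2) R} (hB : IsUnit B) :
    IsUnit (diagPow m B) := by
  obtain ⟨u, rfl⟩ := hB
  have h : ∀ C D : Matrix (Fin 2) (Fin 2) R, C * D = 1 → diagPow m C * diagPow m D = 1 := by
    intro C D hCD
    have : pairDiag (Fin (2 ^ m)) C * pairDiag (Fin (2 ^ m)) D = 1 := by
      ext ⟨i, a⟩ ⟨j, b⟩
      have h1 := congrFun (congrFun hCD a) b
      rw [mul_apply] at h1
      rw [mul_apply, Fintype.sum_prod_type]
      by_cases hij : i = j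
      · subst hij
        rw [Finset.sum_eq_single i]
        · simp only [pairDiag, if_true, h1, one_apply, Prod.mk.injEq, true_and]
        · intro k _ hk
          simp [pairDiag, hk]
        · simp
      · rw [Finset.sum_eq_zero]
        · simp [hij]
        · intro k _
          by_cases hik : i = k
          · subst hik
            simp [pairDiag, hij]
          · simp [pairDiag, hik]
    simp only [diagPow, reindex_apply]
    rw [submatrix_mul_equiv, this, submatrix_one_equiv]
  exact IsUnit.of_mul_eq_one _ (h _ _ u.mul_inv)

lemma isUnit_matE (n : ℕ) : IsUnit (matE R n) := by
  have hσ : IsUnit (!![0, 1; 1, 0] : Matrix (Fin 2) (Fin 2) R) :=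
    IsUnit.of_mul_eq_one !![0, 1; 1, 0] (by simp [one_fin_two])
  have hψ : IsUnit (!![0, 1; -1, 0] : Matrix (Fin 2) (Fin 2) R) :=
    IsUnit.of_mul_eq_one !![0, -1; 1, 0] (by simp [one_fin_two])
  have hJ : ∀ m : ℕ, IsUnit (matJ R (m + 2))ᵀ := fun m =>
    (isUnit_transpose _).mpr (isUnit_jmat (n := m + 1))
  induction n with
  | zero => exact isUnit_one
  | succ n ih =>
    match n, ih with
    | 0, _ => exact isUnit_one
    | 1, _ => exact isUnit_one
    | m + 2, ih =>
      rw [matE]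
      split_ifs
      · exact (((isUnit_blk_diag isUnit_one (hJ m)).mul (isUnit_blk_lower _)).mul
          (isUnit_blk_upper _)).mul (isUnit_blk_diag isUnit_one (isUnit_diagPow hψ))
      · exact (isUnit_blk_diag ih ih).mul (isUnit_blk_diag isUnit_one (isUnit_diagPow hψ))
      · exact (((isUnit_blk_diag isUnit_one (hJ m)).mul (isUnit_blk_lower _)).mul
          (isUnit_blk_upper _)).mul (isUnit_blk_diag isUnit_one (isUnit_diagPow hσ))
      · exact (isUnit_blk_diag ih ih).mul (isUnit_blk_diag isUnit_one (isUnit_diagPow hσ))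

end Suslin

/-! ### Congruence and the hyperbolic image -/

section Congruence

variable {R : Type*} [CommRing R] [Invertible (2 : R)]

/-- Congruent forms agree modulo the image of the hyperbolic map: after adding a negative of `M`,
the form `M` becomes hyperbolic, and `GᵀMG` becomes a form `Pᵀ h P`. -/
lemma coker_mk_eq_of_congr {ε : ℤˣ} {r : ℕ}
    {M M' G : Matrix (Fin r × Fin 2) (Fin r × Fin 2) R} (hM : IsForm ε M) (hM' : IsForm ε M')
    (hG : IsUnit G) (h : M' = Gᵀ * M * G) :
    (QuotientAddGroup.mk (Witt.mk ⟨r, M', hM'⟩) : Coker ε R) =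
      QuotientAddGroup.mk (Witt.mk ⟨r, M, hM⟩) := by
  rw [QuotientAddGroup.eq, ← neg_mem_iff, neg_add_rev, neg_neg]
  obtain ⟨E, hE, hEq⟩ := perp_negMat hM
  have hEu : IsUnit E := by
    obtain ⟨F, -, h1, -⟩ := elementary_inv hE
    exact IsUnit.of_mul_eq_one F h1
  set P : Matrix ((Fin r ⊕ Fin r) × Fin 2) ((Fin r ⊕ Fin r) × Fin 2) R :=
    (fromBlocks G 0 0 1).submatrix (Equiv.sumProdDistrib _ _ _) (Equiv.sumProdDistrib _ _ _)
    with hP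
  have hPu : IsUnit P :=
    (isUnit_submatrix_equiv _ _).mpr (isUnit_fromBlocks_zero₁₂.mpr ⟨hG, isUnit_one⟩)
  have hperp : perp M' (negMat ε M) = (E * P)ᵀ * hyp R ε (Fin r ⊕ Fin r) * (E * P) := by
    have h1 : perp M' (negMat ε M) = Pᵀ * perp M (negMat ε M) * P := by
      rw [hP, perp, perp, transpose_submatrix, submatrix_mul_equiv, submatrix_mul_equiv, h]
      simp [fromBlocks_transpose, fromBlocks_multiply]
    rw [h1, hEq]
    simp only [transpose_mul, mul_assoc]
  let e : Fin (r + r) × Fin 2 ≃ (Fin r ⊕ Fin r) × Fin 2 :=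
    finSumFinEquiv.symm.prodCongr (Equiv.refl _)
  have hQ : IsUnit ((E * P).submatrix e e) := (isUnit_submatrix_equiv e e).mpr (hEu.mul hPu)
  obtain ⟨Q, hQ⟩ := hQ
  have hrel : (Form.hyperbolicOf ε Q).mat =
      relabel finSumFinEquiv.symm (perp M' (negMat ε M)) := by
    change Q.valᵀ * hyp R ε (Fin (r + r)) * Q.val = _
    rw [hQ, hperp, ← relabel_hyp ε (finSumFinEquiv.symm : Fin (r + r) ≃ Fin r ⊕ Fin r),
      transpose_submatrix]
    change _ * (hyp R ε (Fin r ⊕ Fin r)).submatrix e e * _ = submatrix _ e e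
    rw [submatrix_mul_equiv, submatrix_mul_equiv]
  refine AddSubgroup.subset_closure ⟨r + r, Q, ?_⟩
  rw [add_comm]
  refine (Witt.mk_eq (M := Form.add ⟨r, M', hM'⟩ (Form.neg ⟨r, M, hM⟩))).mpr
    (Stable.of_pairCong ((Form.add_stable _ _).trans ?_))
  rw [hrel]
  exact (PairCong.of_relabel _ _).symm

end Congruence

/-! ### The comparison map and the degree map -/

section Main

variable {R : Type*} [CommRing R] {n : ℕ}

/-- Unit vectors whose first components lie in the same `SL_n`-orbit lie in the same orbit of the
Spin group. -/
lemma spin_rel_of_sl_rel [Invertible (2 : R)] {x y : UnitVec n R}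
    (h : slSetoid n R x.fst y.fst) : spinSetoid n R x y := by
  obtain ⟨g, hg⟩ := h
  have hgh : ((g⁻¹ : SpecialLinearGroup (Fin n) R).valᵀ)ᵀ * g.val = 1 := by
    rw [transpose_transpose]
    exact congrArg Subtype.val (inv_mul_cancel g)
  have hdet : (g⁻¹ : SpecialLinearGroup (Fin n) R).valᵀ.det = 1 := by
    rw [det_transpose]
    exact (g⁻¹).2
  obtain ⟨T, hT, h1⟩ := exists_spin_of_det_eq_one g.val _ hgh hdet
  have hq : y.val.1 ⬝ᵥ ((g⁻¹ : SpecialLinearGroup (Fin n) R).valᵀ *ᵥ x.val.2) = 1 := by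
    have hg' : g.val *ᵥ x.val.1 = y.val.1 := hg
    rw [← hg', dotProduct_mulVec, ← mulVec_transpose, mulVec_mulVec, hgh, one_mulVec]
    exact x.2
  obtain ⟨T', hT', h2⟩ := exists_spin_of_fst_eq _ _ _ hq y.2
  refine ⟨T' * T, mul_mem hT' hT, ?_⟩
  have h3 := h1 x.val
  have hg' : g.val *ᵥ x.val.1 = y.val.1 := hg
  rw [hg'] at h3
  refine Eq.trans ?_ h2
  rw [← h3]
  simp [mul_assoc]

lemma exists_unitVec_fst (a : Um n R) : ∃ x : UnitVec n R, x.fst = a := by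
  obtain ⟨a, ha⟩ := a
  have h1 : (1 : R) ∈ Ideal.span (Set.range a) := ha ▸ Submodule.mem_top
  obtain ⟨c, hc⟩ := (Ideal.mem_span_range_iff_exists_fun).mp h1
  exact ⟨⟨(a, c), by simpa [mul_comm] using hc⟩, rfl⟩

lemma exists_degMat_eq (m : ℕ) (hn : 3 ≤ m + 1) :
    ∃ (E : Matrix (Fin (2 ^ m)) (Fin (2 ^ m)) R)
      (e : Fin (2 ^ (m + 1 - 2)) × Fin 2 ≃ Fin (2 ^ m)), IsUnit E ∧
      ∀ x : UnitVec (m + 1) R, degMat hn x =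
        (Eᵀ * (sus m x.val.1 x.val.2 * jmat R m) * E).submatrix e e :=
  ⟨matE R (m + 1), _, isUnit_matE (m + 1), fun _ => by rw [← mul_assoc]; rfl⟩

lemma isForm_degMat [Invertible (2 : R)] (hn : 3 ≤ n) (hodd : Odd n) (x : UnitVec n R) :
    IsForm (degSign n) (degMat hn x) := by
  obtain ⟨m, rfl⟩ : ∃ m, n = m + 1 := ⟨n - 1, by omega⟩
  have hm : Even m := by simpa [parity_simps] using hodd
  obtain ⟨E, e, hE, hdeg⟩ := exists_degMat_eq (R := R) m hn
  rw [hdeg x]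
  have hSJ := (sus_mul_jmat x.val.1 x.val.2).1 hm
  have hSu : IsUnit (sus m x.val.1 x.val.2) := by
    refine IsUnit.of_mul_eq_one (sus m x.val.2 x.val.1)ᵀ ?_
    have : x.val.1 ⬝ᵥ x.val.2 = 1 := x.2
    rw [(sus_mul_transpose _ _).1, this, one_smul]
  have h1 : (sus m x.val.1 x.val.2 * jmat R m)ᵀ =
      sgn R (degSign (m + 1)) • (sus m x.val.1 x.val.2 * jmat R m) := by
    obtain ⟨k, rfl⟩ := hm
    rw [transpose_mul, hSJ, degSign]
    rcases jmat_transpose (R := R) (n := k + k) with ⟨h, hk⟩ | ⟨h, hk⟩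
    · rw [if_pos (by omega), h]
      simp [sgn]
    · rw [if_neg (by omega), h]
      simp [sgn]
  generalize sus m x.val.1 x.val.2 = S at *
  have ht : ((Eᵀ * (S * jmat R m) * E).submatrix e e)ᵀ =
      sgn R (degSign (m + 1)) • (Eᵀ * (S * jmat R m) * E).submatrix e e := by
    rw [transpose_submatrix, transpose_mul, transpose_mul, transpose_transpose, h1,
      Matrix.smul_mul, Matrix.mul_smul, ← mul_assoc]
    rfl
  refine ⟨(isUnit_submatrix_equiv _ _).mpr
    ((((isUnit_transpose _).mpr hE).mul (hSu.mul isUnit_jmat)).mul hE), ht, ?_⟩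
  intro hs
  rw [hs] at ht
  exact diag_eq_zero ht

lemma degMat_congr (hn : 3 ≤ n) (hodd : Odd n) {x y : UnitVec n R}
    (h : spinSetoid n R x y) :
    ∃ G : Matrix (Fin (2 ^ (n - 2)) × Fin 2) (Fin (2 ^ (n - 2)) × Fin 2) R,
      IsUnit G ∧ degMat hn y = Gᵀ * degMat hn x * G := by
  obtain ⟨m, rfl⟩ : ∃ m, n = m + 1 := ⟨n - 1, by omega⟩
  have hm : Even m := by simpa [parity_simps] using hodd
  obtain ⟨g, hg, h⟩ := h
  obtain ⟨G, hG, h⟩ := exists_sus_congr hm hg h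
  obtain ⟨_, e, ⟨E, rfl⟩, hdeg⟩ := exists_degMat_eq (R := R) m hn
  refine ⟨(E⁻¹.val * Gᵀ * E.val).submatrix e e, (isUnit_submatrix_equiv _ _).mpr
    ((E⁻¹.isUnit.mul ((isUnit_transpose _).mpr hG)).mul E.isUnit), ?_⟩
  rw [hdeg, hdeg, h, transpose_submatrix, submatrix_mul_equiv, submatrix_mul_equiv]
  congr 1
  have h1 : E⁻¹.valᵀ * E.valᵀ = 1 := by rw [← transpose_mul, E.mul_inv, transpose_one]
  simp only [transpose_mul, transpose_transpose, mul_assoc]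
  rw [← mul_assoc E.val E⁻¹.val, E.mul_inv, one_mul, ← mul_assoc E⁻¹.valᵀ, h1, one_mul]

end Main

end SpinUnit

theorem mainTheorem10 {R : Type*} [CommRing R] [Invertible (2 : R)] (n : ℕ) (hn : 3 ≤ n)
    (hodd : Odd n) :
    (∃! c : SpinUnit.UmModSL n R → SpinUnit.UnitVecModSpin n R, SpinUnit.IsComparisonMap c) ∧
    (∃! d : SpinUnit.UnitVecModSpin n R → SpinUnit.Coker (SpinUnit.degSign n) R,
      SpinUnit.IsDegreeMap hn d) ∧
    ∀ (c : SpinUnit.UmModSL n R → SpinUnit.UnitVecModSpin n R)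
      (d : SpinUnit.UnitVecModSpin n R → SpinUnit.Coker (SpinUnit.degSign n) R),
      SpinUnit.IsComparisonMap c → SpinUnit.IsDegreeMap hn d →
        Function.Injective (d ∘ c) → Function.Bijective c := by
  refine ⟨?_, ?_, ?_⟩
  · choose f hf using SpinUnit.exists_unitVec_fst (R := R) (n := n)
    refine ⟨Quotient.map f fun a b hab => SpinUnit.spin_rel_of_sl_rel (by rwa [hf, hf]),
      fun x => Quotient.sound (SpinUnit.spin_rel_of_sl_rel (by rw [hf])), ?_⟩
    intro c hc
    funext a
    induction a using Quotient.inductionOn with | _ a => ?_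
    have := hc (f a)
    rw [hf] at this
    exact this
  · refine ⟨Quotient.lift (fun x => QuotientAddGroup.mk (SpinUnit.Witt.mk
      ⟨2 ^ (n - 2), SpinUnit.degMat hn x, SpinUnit.isForm_degMat hn hodd x⟩)) ?_,
      fun x => ⟨SpinUnit.isForm_degMat hn hodd x, rfl⟩, ?_⟩
    · intro x y hxy
      obtain ⟨G, hG, h⟩ := SpinUnit.degMat_congr hn hodd hxy
      exact (SpinUnit.coker_mk_eq_of_congr _ _ hG h).symm
    · intro d hd
      funext x
      induction x using Quotient.inductionOn with | _ x => ?_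
      obtain ⟨_, h⟩ := hd x
      exact h
  · intro c d hc _ hinj
    refine ⟨hinj.of_comp, fun y => ?_⟩
    induction y using Quotient.inductionOn with | _ x => ?_
    exact ⟨_, hc x⟩
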